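/- Notation. For $c,d>0$ let $\beta^{(2)}_{c,d}$ be the law on $(0,\infty)$ with density $\frac{1}{B(c,d)}\frac{w^{c-1}}{(1+w)^{c+d}}$. For $\theta=(\theta_1,\dots,\theta_5)\in\mathbb R^5$ put $$a=\theta_4+\theta_5,\quad b=\theta_1+\theta_3,\quad p=\theta_3+\theta_5,\quad q=\theta_3+\theta_4,\quad r=\theta_2+\theta_3+\theta_4+\theta_5 .$$ We say that $BH_\theta$ exists if $r\notin\{0,-1,-2,\dots\}$, ${}_2F_1(p,q;r;x)>0$ for all $x\in(0,1)$, and $a,\ b,\ r+b-p-q>0$. In this case $BH_\theta$ is the probability law on $(0,1)$ with density proportional to $x^{a-1}(1-x)^{b-1}{}_2F_1(p,q;r;x)$. Existence of $BH_\theta$ and the law itself depend only on the triple $v_\theta=(\theta_1,\{\theta_2,\theta_3\},\{\theta_4,\theta_5\})$, where the pairs are unordered (multisets), so we write $BH_v$ for $v=v_\theta$. Fix $\theta\in\mathbb R^5$. The vertices of the finite directed graph $G_\theta$ are the triples $v_{\theta'}$, where $\theta'$ runs through the rearrangements of $(\theta_1,\dots,\theta_5)$. From a vertex $v=(\eta_1,\{\eta_2,\eta_3\},\{\eta_4,\eta_5\})$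 there are edges to $(\eta_5,\{\eta_1,\eta_4\},\{\eta_2,\eta_3\})$ and to $(\eta_4,\{\eta_1,\eta_5\},\{\eta_2,\eta_3\})$ (which may coincide). Such an edge is acceptable if $\eta_2+\eta_3>0$ and, respectively, $\eta_1+\eta_5>0$ or $\eta_1+\eta_4>0$; to an acceptable edge $(v,v')$ we attach the law $\beta^{(v,v')}=\beta^{(2)}_{\eta_1+\eta_5,\,\eta_2+\eta_3}$, respectively $\beta^{(2)}_{\eta_1+\eta_4,\,\eta_2+\eta_3}$. The graph $G^{**}_\theta$ is obtained from $G_\theta$ by removing all edges that are not acceptable, and all vertices $v$ for which $BH_v$ does not exist together with their adjacent edges. **Theorem 4.2.** Let $\cdots\to v_n\to v_{n-1}\to\cdots\to v_2\to v_1\to v_0$ be an infinite path in $G^{**}_\theta$ (its vertices need not be distinct), and let $W_1,W_2,\dots$ be independent random variables with $W_n\sim\beta^{(v_n,v_{n-1})}$ for all $n\ge1$. Put $H_w(x)=\frac1{1+wx}$ and $Z_n(x)=H_{W_1}\circ H_{W_2}\circ\cdots\circ H_{W_n}(x)$ for $x\ge0$. Then almost surely the limit $$Z=\lim_{n\to\infty}Z_n(x)=\cfrac{1}{1+\cfrac{W_1}{1+\cfrac{W_2}{1+\cdots}}}$$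 exists for all $x\ge 0$ and does not depend on $x$. Moreover $Z\sim BH_{v_0}$. -/

import Mathlib

open MeasureTheory ProbabilityTheory Filter Topology

noncomputable section

namespace BetaHyp

/-- The function `h(a,b,p,q,r;x) = x^(a-1) (1-x)^(b-1) ₂F₁(p,q;r;x)`, used for `0 < x < 1`. -/
def h (a b p q r x : ℝ) : ℝ :=
  x ^ (a - 1) * (1 - x) ^ (b - 1) * ordinaryHypergeometric p q r x

/-- The set of admissible parameters `(a,b,p,q,r)` of the beta hypergeometric distributions. -/
def Admissible (a b p q r : ℝ) : Prop :=
  (∀ n : ℕ, r ≠ -(n : ℝ)) ∧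
  (∀ x ∈ Set.Ioo (0 : ℝ) 1, 0 < ordinaryHypergeometric p q r x) ∧
  0 < a ∧ 0 < b ∧ 0 < r + b - p - q

/-- The measure `h(a,b,p,q,r;x) dx` on `(0,1)`. -/
def unnormalizedBH (a b p q r : ℝ) : Measure ℝ :=
  (volume.restrict (Set.Ioo (0 : ℝ) 1)).withDensity fun x => ENNReal.ofReal (h a b p q r x)

/-- The law `BH(a,b,p,q,r)` on `(0,1)` whose density is proportional to `h(a,b,p,q,r;x)`.
It is meaningful for admissible parameters, for which the total mass of
`h(a,b,p,q,r;x) dx` is positive and finite. -/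
def BH (a b p q r : ℝ) : Measure ℝ :=
  (unnormalizedBH a b p q r Set.univ)⁻¹ • unnormalizedBH a b p q r

/-- The beta distribution of the second kind, with density
`w^(c-1) / (B(c,d) (1+w)^(c+d))` on `(0,∞)`. It is meaningful for `c, d > 0`. -/
def betaPrime (c d : ℝ) : Measure ℝ :=
  (volume.restrict (Set.Ioi (0 : ℝ))).withDensity fun w =>
    ENNReal.ofReal (1 / ProbabilityTheory.beta c d * (w ^ (c - 1) / (1 + w) ^ (c + d)))

/-! The parameters `θ₁, …, θ₅` are `θ 0, …, θ 4`. -/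

/-- `BH_θ` exists: `a = θ₄+θ₅`, `b = θ₁+θ₃`, `p = θ₃+θ₅`, `q = θ₃+θ₄`, `r = θ₂+θ₃+θ₄+θ₅`
are admissible. -/
def ThetaAdmissible (θ : Fin 5 → ℝ) : Prop :=
  Admissible (θ 3 + θ 4) (θ 0 + θ 2) (θ 2 + θ 4) (θ 2 + θ 3) (θ 1 + θ 2 + θ 3 + θ 4)

/-- The law `BH_θ`, in the same parameters. -/
def BHθ (θ : Fin 5 → ℝ) : Measure ℝ :=
  BH (θ 3 + θ 4) (θ 0 + θ 2) (θ 2 + θ 4) (θ 2 + θ 3) (θ 1 + θ 2 + θ 3 + θ 4)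

/-- Triples consisting of a number and two unordered pairs (multisets of two elements). -/
abbrev Triple : Type := ℝ × Sym2 ℝ × Sym2 ℝ

/-- `v_θ = (θ₁, {θ₂, θ₃}, {θ₄, θ₅})`. -/
def triple (θ : Fin 5 → ℝ) : Triple := (θ 0, s(θ 1, θ 2), s(θ 3, θ 4))

/-- `v₁ = (θ₅, {θ₁, θ₄}, {θ₂, θ₃})`. -/
def succ₁ (θ : Fin 5 → ℝ) : Triple := (θ 4, s(θ 0, θ 3), s(θ 1, θ 2))

/-- `v₂ = (θ₄, {θ₁, θ₅}, {θ₂, θ₃})`. -/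
def succ₂ (θ : Fin 5 → ℝ) : Triple := (θ 3, s(θ 0, θ 4), s(θ 1, θ 2))

/-- The edges `v_θ → v₁` and `v_θ → v₂`. -/
def IsEdge (v v' : Triple) : Prop :=
  ∃ θ : Fin 5 → ℝ, v = triple θ ∧ (v' = succ₁ θ ∨ v' = succ₂ θ)

/-- An edge from `v_θ` is acceptable if `θ₂+θ₃ > 0` and moreover `θ₁+θ₅ > 0` for the edge to `v₁`,
`θ₁+θ₄ > 0` for the edge to `v₂`. -/
def IsAcceptable (v v' : Triple) : Prop :=
  ∃ θ : Fin 5 → ℝ, v = triple θ ∧ 0 < θ 1 + θ 2 ∧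
    ((v' = succ₁ θ ∧ 0 < θ 0 + θ 4) ∨ (v' = succ₂ θ ∧ 0 < θ 0 + θ 3))

/-- The law `BH_v` attached to the triple `v` exists. -/
def BHExists (v : Triple) : Prop := ∃ θ : Fin 5 → ℝ, triple θ = v ∧ ThetaAdmissible θ

/-- The vertices of `G_θ`: all triples obtained by rearranging the numbers `θ₁, …, θ₅`. -/
def Vert (θ : Fin 5 → ℝ) : Set Triple := {v | ∃ σ : Equiv.Perm (Fin 5), v = triple (θ ∘ σ)}

/-- The directed graph `G_θ`. -/
def G (θ : Fin 5 → ℝ) : Digraph (Vert θ) where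
  Adj v v' := IsEdge v v'

/-- The directed graph `G*_θ`: the non acceptable edges of `G_θ` are removed. -/
def Gstar (θ : Fin 5 → ℝ) : Digraph (Vert θ) where
  Adj v v' := (G θ).Adj v v' ∧ IsAcceptable v v'

/-- The directed graph `G**_θ`: the vertices `v` of `G*_θ` for which `BH_v` does not exist are
removed, with the adjacent edges. -/
def Gstarstar (θ : Fin 5 → ℝ) : Digraph {v : Vert θ // BHExists v} where
  Adj v v' := (Gstar θ).Adj v.1 v'.1

/-- The law `β^(v,v')` attached to an edge. The first components of `v_θ` and `v₁` add up
to `θ₁+θ₅`, those of `v_θ` and `v₂` to `θ₁+θ₄`, and the first pair of `v_θ` has sum `θ₂+θ₃`. -/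
def edgeLaw (v v' : Triple) : Measure ℝ := betaPrime (v.1 + v'.1) v.2.1.add

theorem edgeLaw_succ₁ (θ : Fin 5 → ℝ) :
    edgeLaw (triple θ) (succ₁ θ) = betaPrime (θ 0 + θ 4) (θ 1 + θ 2) := rfl

theorem edgeLaw_succ₂ (θ : Fin 5 → ℝ) :
    edgeLaw (triple θ) (succ₂ θ) = betaPrime (θ 0 + θ 3) (θ 1 + θ 2) := rfl

/-- The Moebius transformation `H_w(x) = 1 / (1 + w x)`. -/
def moebius (w x : ℝ) : ℝ := 1 / (1 + w * x)

/-- `Z w n x = H_{w 0} ∘ H_{w 1} ∘ ⋯ ∘ H_{w (n-1)} (x)`. -/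
def Z (w : ℕ → ℝ) : ℕ → ℝ → ℝ
  | 0, x => x
  | n + 1, x => Z w n (moebius (w n) x)

end BetaHyp

end

noncomputable section

namespace BetaHyp

/-! ### Coefficients of the hypergeometric series -/

/-! Each edge carries an exact identity in law: if `X ∼ BH_v` and `W ∼ β^(v,v')` are independent,
then `1 / (1 + W X) ∼ BH_v'` (`lintegral_moebius_BH`). Given `X = x`, the variable `1 / (1 + W x)`
has an explicit density with kernel `(1 - y (1 - x)) ^ (-(c + d))`. Expanding it binomially leaves
the moments `∫ x^(r-1) (1-x)^(b+n-1) ₂F₁(p,q;r;x) dx`; by the contiguity relation `integral_h_succ`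
they obey a two-term recursion, and the sum over `n` is again a `₂F₁`. Symmetry in `p, q` and
Euler's transformation show that only the triple matters.

Going back along the path, `Z_n(X_n) ∼ BH_{v_0}` whenever `X_n ∼ BH_{v_n}` is independent of the
`W_k` (`map_Z`). On `[0,1]` the oscillation of `Z_n` is at most `∏ W_k / (1 + W_k)`. The graph is
finite, so only finitely many edge laws occur, each charging `(0,1)`; by Borel–Cantelli infinitely
many `W_k` are at most `1` and the product tends to `0`. Hence `Z_n(x)` converges to a limit not
depending on `x`, and `Z_n(X_n)` shares that limit, which therefore has law `BH_{v_0}`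
(`map_limit_Z`). -/

/-- The coefficient of `x ^ n` in `₂F₁(p,q;r;x)`. -/
def coef (p q r : ℝ) (n : ℕ) : ℝ := ordinaryHypergeometricCoefficient p q r n

theorem coef_zero (p q r : ℝ) : coef p q r 0 = 1 := by
  simp [coef, ordinaryHypergeometricCoefficient]

theorem coef_succ {p q r : ℝ} (hr : ∀ n : ℕ, r ≠ -(n : ℝ)) (n : ℕ) :
    (n + 1) * (r + n) * coef p q r (n + 1) = (p + n) * (q + n) * coef p q r n := by
  have h1 : r + n ≠ 0 := fun h => hr n (by linarith)
  have h2 : (n : ℝ) + 1 ≠ 0 := by positivity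
  have h3 : (ascPochhammer ℝ n).eval r ≠ 0 := by
    rw [Ne, ascPochhammer_eval_eq_zero_iff]
    rintro ⟨k, -, hk⟩
    exact hr k (by linarith)
  have h4 : (n.factorial : ℝ) ≠ 0 := by positivity
  simp only [coef, ordinaryHypergeometricCoefficient, ascPochhammer_succ_eval,
    Nat.factorial_succ]
  push_cast
  field_simp

/-- Since `r + n` never vanishes, the recursion determines the sequence. It serves twice: for
Euler's transformation and for the moments of `h`. -/
theorem coef_unique {p q r : ℝ} (hr : ∀ n : ℕ, r ≠ -(n : ℝ)) {f : ℕ → ℝ} (h0 : f 0 = 1)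
    (hf : ∀ n : ℕ, (n + 1) * (r + n) * f (n + 1) = (p + n) * (q + n) * f n) (n : ℕ) :
    f n = coef p q r n := by
  induction n with
  | zero => rw [h0, coef_zero]
  | succ n ih =>
    have h1 : r + n ≠ 0 := fun h => hr n (by linarith)
    have h2 : (n : ℝ) + 1 ≠ 0 := by positivity
    refine mul_left_cancel₀ (mul_ne_zero h2 h1) ?_
    rw [hf, coef_succ hr, ih]

theorem hyp_comm (p q r x : ℝ) :
    ordinaryHypergeometric p q r x = ordinaryHypergeometric q p r x := by
  simp only [ordinaryHypergeometric, ordinaryHypergeometricSeries_symm p q r]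

theorem tendsto_ratio (p q r : ℝ) :
    Tendsto (fun n : ℕ => (p + n) * (q + n) / ((n + 1) * (r + n))) atTop (𝓝 1) := by
  have h1 := tendsto_add_mul_div_add_mul_atTop_nhds p r (1 : ℝ) one_ne_zero
  have h2 := tendsto_add_mul_div_add_mul_atTop_nhds q 1 (1 : ℝ) one_ne_zero
  have := h1.mul h2
  simp only [one_mul, div_one, mul_one] at this
  refine this.congr fun n => ?_
  rw [div_mul_div_comm, add_comm 1 (n : ℝ), mul_comm (r + (n : ℝ))]

theorem coef_succ_eq {p q r : ℝ} (hr : ∀ n : ℕ, r ≠ -(n : ℝ)) (n : ℕ) :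
    coef p q r (n + 1) = (p + n) * (q + n) / ((n + 1) * (r + n)) * coef p q r n := by
  have h1 : r + n ≠ 0 := fun h => hr n (by linarith)
  have h2 : (n : ℝ) + 1 ≠ 0 := by positivity
  have := coef_succ (p := p) (q := q) hr n
  field_simp
  linarith

theorem summable_coef_mul_pow {p q r : ℝ} (hr : ∀ n : ℕ, r ≠ -(n : ℝ)) {x : ℝ} (hx : |x| < 1) :
    Summable fun n => coef p q r n * x ^ n := by
  refine summable_of_ratio_norm_eventually_le (r := (|x| + 1) / 2) (by linarith) ?_
  have := ((tendsto_ratio p q r).abs.mul_const |x|)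
  have h2 : |(1 : ℝ)| * |x| < (|x| + 1) / 2 := by
    rw [abs_one]; linarith
  filter_upwards [this.eventually (gt_mem_nhds h2)] with n hn
  rw [coef_succ_eq hr, pow_succ]
  calc ‖(p + n) * (q + n) / ((n + 1) * (r + n)) * coef p q r n * (x ^ n * x)‖
      = (|(p + n) * (q + n) / ((n + 1) * (r + n))| * |x|) * ‖coef p q r n * x ^ n‖ := by
        simp only [Real.norm_eq_abs, abs_mul]; ring
    _ ≤ _ := by gcongr

theorem hyp_eq_tsum (p q r x : ℝ) :
    ordinaryHypergeometric p q r x = ∑' n, coef p q r n * x ^ n := by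
  rw [ordinaryHypergeometric_eq_tsum]
  simp [coef, ordinaryHypergeometricCoefficient]

theorem hasSum_hyp {p q r : ℝ} (hr : ∀ n : ℕ, r ≠ -(n : ℝ)) {x : ℝ} (hx : |x| < 1) :
    HasSum (fun n => coef p q r n * x ^ n) (ordinaryHypergeometric p q r x) := by
  rw [hyp_eq_tsum]
  exact (summable_coef_mul_pow hr hx).hasSum

theorem measurable_hyp (p q r : ℝ) : Measurable fun x : ℝ => ordinaryHypergeometric p q r x := by
  simp_rw [hyp_eq_tsum]
  exact Measurable.tsum fun n => by fun_prop

/-! ### The binomial series -/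

theorem one_ne_neg_nat (n : ℕ) : (1 : ℝ) ≠ -(n : ℝ) := by
  have : (0 : ℝ) ≤ n := n.cast_nonneg
  intro h; linarith

/-- Treating the binomial series as a `₂F₁` makes the recursion and the summability of `coef`
available for it. -/
theorem hyp_one_one (s : ℝ) {x : ℝ} (hx : |x| < 1) :
    ordinaryHypergeometric s 1 1 x = (1 - x) ^ (-s) := by
  have h := (Real.one_div_one_sub_rpow_hasFPowerSeriesOnBall_zero s).hasSum_sub (y := x) (by
    simpa [← ENNReal.ofReal_one, Metric.eball_ofReal] using hx)
  have hc : ∀ n : ℕ, Ring.choose (s + n - 1) n = coef s 1 1 n := by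
    intro n
    have h1 : Ring.choose (s + n - 1) n = Ring.multichoose s n := by
      rw [Ring.choose]; congr 1; ring
    have h2 := Ring.factorial_nsmul_multichoose_eq_ascPochhammer s n
    rw [h1, Polynomial.ascPochhammer_smeval_eq_eval, nsmul_eq_mul] at *
    have h4 : (n.factorial : ℝ) ≠ 0 := by positivity
    have h3 : (ascPochhammer ℝ n).eval (1 : ℝ) ≠ 0 := by
      rw [Ne, ascPochhammer_eval_eq_zero_iff]
      rintro ⟨k, -, hk⟩
      exact one_ne_neg_nat k (by linarith)
    rw [coef, ordinaryHypergeometricCoefficient, ← h2]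
    field_simp
  rw [hyp_eq_tsum, Real.rpow_neg (by linarith [(abs_lt.1 hx).2]), ← one_div, ← h.tsum_eq]
  simp [hc, mul_comm]

/-! ### Euler's transformation -/

open PowerSeries in
/-- The hypergeometric differential operator on formal power series. -/
def hypOp (p q r : ℝ) (f : ℝ⟦X⟧) : ℝ⟦X⟧ :=
  X * (1 - X) * d⁄dX ℝ (d⁄dX ℝ f) + (C r - C (p + q + 1) * X) * d⁄dX ℝ f - C (p * q) * f

open PowerSeries in
theorem coeff_hypOp (p q r : ℝ) (f : ℝ⟦X⟧) (n : ℕ) :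
    coeff n (hypOp p q r f) =
      (n + 1) * (r + n) * coeff (n + 1) f - (p + n) * (q + n) * coeff n f := by
  have : hypOp p q r f = X * d⁄dX ℝ (d⁄dX ℝ f) - X * (X * d⁄dX ℝ (d⁄dX ℝ f)) +
      C r * d⁄dX ℝ f - C (p + q + 1) * (X * d⁄dX ℝ f) - C (p * q) * f := by
    rw [hypOp]; ring
  -- Naming `p + q + 1` keeps `map_add` from splitting the constant.
  obtain ⟨e, he⟩ : ∃ e, e = p + q + 1 := ⟨_, rfl⟩
  rw [this, ← he]
  rcases n with _ | _ | n <;>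
  simp only [map_add, map_sub, coeff_C_mul, coeff_succ_X_mul, coeff_derivative, coeff_zero_X_mul]
  all_goals rw [he]; push_cast; ring

open PowerSeries in
theorem hypOp_mk_coef {p q r : ℝ} (hr : ∀ n : ℕ, r ≠ -(n : ℝ)) :
    hypOp p q r (mk (coef p q r)) = 0 := by
  ext n
  rw [coeff_hypOp, coeff_mk, coeff_mk, coef_succ hr]
  simp

open PowerSeries in
theorem derivative_mk_coef_one (u : ℝ) :
    (1 - X) * d⁄dX ℝ (mk (coef u 1 1)) = C u * mk (coef u 1 1) := by
  have : ∀ n : ℕ, ((n : ℝ) + 1) * coef u 1 1 (n + 1) = (u + n) * coef u 1 1 n := by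
    intro n
    have h := coef_succ (p := u) (q := 1) one_ne_neg_nat n
    have h2 : (1 + n : ℝ) ≠ 0 := by positivity
    apply mul_left_cancel₀ h2
    linarith
  ext n
  rw [sub_mul, one_mul]
  rcases n with _ | n <;>
  simp only [map_sub, coeff_C_mul, coeff_succ_X_mul, coeff_derivative, coeff_zero_X_mul, coeff_mk]
  · have := this 0
    push_cast at *
    linarith
  · have := this (n + 1)
    push_cast at *
    linarith

open PowerSeries in
-- The left side is `(1 - X)^(r-p-q)` times a `₂F₁`. It is killed by `hypOp p q r`, and a solution
-- with constant term `1` is unique.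
theorem mk_coef_euler {p q r : ℝ} (hr : ∀ n : ℕ, r ≠ -(n : ℝ)) :
    mk (coef (p + q - r) 1 1) * mk (coef (r - p) (r - q) r) = mk (coef p q r) := by
  set u := p + q - r with hu
  set B : ℝ⟦X⟧ := mk (coef u 1 1) with hB
  set F : ℝ⟦X⟧ := mk (coef (r - p) (r - q) r) with hF
  have h1 : (1 - X) * d⁄dX ℝ B = C u * B := derivative_mk_coef_one u
  have h2 : (1 - X) * d⁄dX ℝ (d⁄dX ℝ B) = (C u + 1) * d⁄dX ℝ B := by
    have := congrArg (d⁄dX ℝ) h1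
    simp only [Derivation.leibniz, smul_eq_mul, map_sub, derivative_X, derivative_C,
      Derivation.map_one_eq_zero] at this
    linear_combination this
  have h3 : hypOp (r - p) (r - q) r F = 0 := hypOp_mk_coef hr
  -- The factor `1 - X` allows the derivatives of `B` to be eliminated by `h1` and `h2`; it cancels
  -- because power series over `ℝ` form a domain.
  have h4 : (1 - X) * hypOp p q r (B * F) = 0 := by
    rw [hypOp] at *
    simp only [Derivation.leibniz, smul_eq_mul, map_add, map_sub, map_mul, map_one] at *
    rw [hu] at h1 h2
    simp only [map_add, map_sub] at h1 h2
    linear_combination X * (1 - X) * F * h2 + X * F * (C p + C q - C r + 1) * h1 +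
      2 * X * (1 - X) * d⁄dX ℝ F * h1 + (C r - (C p + C q + 1) * X) * F * h1 + (1 - X) * B * h3
  have h5 : hypOp p q r (B * F) = 0 := by
    refine (mul_eq_zero.1 h4).resolve_left fun h => ?_
    have := congrArg (coeff 0) h
    simp at this
  ext n
  rw [coeff_mk]
  refine coef_unique hr (f := fun n => coeff n (B * F)) ?_ (fun n => ?_) n
  · simp [coeff_mul, hB, hF, coef_zero]
  · have := congrArg (coeff n) h5
    rw [coeff_hypOp, map_zero] at this
    linarith

/-- **Euler's transformation** of the hypergeometric function. -/
theorem hyp_euler {p q r : ℝ} (hr : ∀ n : ℕ, r ≠ -(n : ℝ)) {x : ℝ} (hx : |x| < 1) :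
    ordinaryHypergeometric p q r x =
      (1 - x) ^ (r - p - q) * ordinaryHypergeometric (r - p) (r - q) r x := by
  have h1 : (1 - x) ^ (r - p - q) = ordinaryHypergeometric (p + q - r) 1 1 x := by
    rw [hyp_one_one _ hx]; congr 1; ring
  rw [h1, hyp_eq_tsum, hyp_eq_tsum, hyp_eq_tsum,
    tsum_mul_tsum_eq_tsum_sum_antidiagonal_of_summable_norm
      (summable_coef_mul_pow one_ne_neg_nat hx).norm (summable_coef_mul_pow hr hx).norm]
  refine tsum_congr fun n => ?_
  have := congrArg (PowerSeries.coeff n) (mk_coef_euler (p := p) (q := q) hr)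
  rw [PowerSeries.coeff_mul, PowerSeries.coeff_mk] at this
  rw [← this, Finset.sum_mul]
  refine Finset.sum_congr rfl fun kl hkl => ?_
  rw [PowerSeries.coeff_mk, PowerSeries.coeff_mk, ← Finset.HasAntidiagonal.mem_antidiagonal.1 hkl, pow_add]
  ring

/-! ### Raabe's test -/

/-- **Raabe's test**, together with the decay of the terms that it yields. -/
theorem summable_of_raabe {t : ℕ → ℝ} (ht : ∀ n, 0 ≤ t n) {δ : ℝ} (hδ : 0 < δ)
    (h : ∀ᶠ n : ℕ in atTop, (n + 1) * t (n + 1) ≤ (n - δ) * t n) :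
    Summable t ∧ Tendsto (fun n : ℕ => (n : ℝ) * t n) atTop (𝓝 0) := by
  obtain ⟨N, hN⟩ := eventually_atTop.1 h
  -- The hypothesis reads `δ t_n ≤ n t_n - (n+1) t_(n+1)`, which telescopes.
  have hsum : Summable t := by
    rw [← summable_nat_add_iff N]
    refine summable_of_sum_range_le (c := N * t N / δ) (fun n => ht _) fun n => ?_
    have key : δ * ∑ i ∈ Finset.range n, t (i + N) ≤ N * t N - (n + N : ℕ) * t (n + N) := by
      induction n with
      | zero => simp
      | succ n ih =>
        rw [Finset.sum_range_succ, mul_add]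
        have := hN (n + N) (by omega)
        rw [show n + 1 + N = n + N + 1 by ring]
        push_cast at *
        linarith
    rw [le_div_iff₀ hδ]
    have : 0 ≤ ((n + N : ℕ) : ℝ) * t (n + N) := mul_nonneg (Nat.cast_nonneg _) (ht _)
    linarith
  refine ⟨hsum, ?_⟩
  have hanti : Antitone fun n : ℕ => ((n + N : ℕ) : ℝ) * t (n + N) := by
    refine antitone_nat_of_succ_le fun n => ?_
    have := hN (n + N) (by omega)
    rw [show n + 1 + N = n + N + 1 by ring]
    have h2 : 0 ≤ δ * t (n + N) := mul_nonneg hδ.le (ht _)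
    push_cast at *
    linarith
  have hbdd : BddBelow (Set.range fun n : ℕ => ((n + N : ℕ) : ℝ) * t (n + N)) :=
    ⟨0, by rintro _ ⟨n, rfl⟩; exact mul_nonneg (Nat.cast_nonneg _) (ht _)⟩
  have hlim := tendsto_atTop_ciInf hanti hbdd
  set L := ⨅ n : ℕ, ((n + N : ℕ) : ℝ) * t (n + N) with hL
  have hlim' : Tendsto (fun n : ℕ => (n : ℝ) * t n) atTop (𝓝 L) :=
    (tendsto_add_atTop_iff_nat (f := fun n : ℕ => (n : ℝ) * t n) N).1 hlim
  have hL0 : 0 ≤ L := le_ciInf fun n => mul_nonneg (Nat.cast_nonneg _) (ht _)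
  rcases hL0.eq_or_lt with h0 | hpos
  · rw [h0]; exact hlim'
  exfalso
  -- A positive limit `L` of `n t_n` would make `t` dominate a harmonic series.
  have hev : ∀ᶠ n : ℕ in atTop, ‖(L / 2) * (1 / (n : ℝ))‖ ≤ t n := by
    filter_upwards [hlim'.eventually (lt_mem_nhds (half_lt_self hpos)), eventually_gt_atTop 0]
      with n hn hn0
    have : (0 : ℝ) < n := by exact_mod_cast hn0
    rw [Real.norm_of_nonneg (by positivity), mul_one_div, div_le_iff₀ this]
    linarith
  have := summable_of_isBigO_nat hsum (Asymptotics.IsBigO.of_bound 1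
    (f := fun n : ℕ => (L / 2) * (1 / (n : ℝ))) (g := t) (by
      filter_upwards [hev] with n hn
      rw [one_mul]; exact hn.trans (le_abs_self _)))
  rw [summable_mul_left_iff (by positivity)] at this
  exact Real.not_summable_one_div_natCast this

theorem eventually_quadratic_nonneg {δ : ℝ} (hδ : 0 < δ) (B C : ℝ) :
    ∀ᶠ n : ℕ in atTop, 0 ≤ δ * (n : ℝ) ^ 2 + B * n + C := by
  filter_upwards [eventually_ge_atTop ⌈(|B| + |C|) / δ⌉₊, eventually_ge_atTop 1] with n hn h1
  have h2 : |B| + |C| ≤ n * δ := (div_le_iff₀ hδ).1 (Nat.ceil_le.1 hn)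
  have h3 : (1 : ℝ) ≤ n := by exact_mod_cast h1
  have h4 : (|B| + |C|) * n ≤ n * δ * n := by gcongr
  have h5 : |C| * 1 ≤ |C| * n := by gcongr
  have h6 : -(|B| * n) ≤ B * n := by
    rw [← neg_mul]; gcongr; exact neg_abs_le B
  linarith [neg_abs_le C]

theorem eventually_pos_add (c : ℝ) : ∀ᶠ n : ℕ in atTop, 0 < c + n := by
  have := tendsto_natCast_atTop_atTop (R := ℝ)
  filter_upwards [this.eventually (eventually_gt_atTop (-c))] with n hn
  linarith

/-! ### Beta integrals -/

theorem beta_succ_left {a b : ℝ} (ha : 0 < a) (hb : 0 < b) :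
    beta (a + 1) b = beta a b * (a / (a + b)) := by
  have h1 : a + b ≠ 0 := by positivity
  have h2 : Real.Gamma (a + b) ≠ 0 := (Real.Gamma_pos_of_pos (by positivity)).ne'
  rw [beta, beta, Real.Gamma_add_one ha.ne', show a + 1 + b = a + b + 1 by ring,
    Real.Gamma_add_one h1]
  field_simp

theorem beta_succ_right {a b : ℝ} (ha : 0 < a) (hb : 0 < b) :
    beta a (b + 1) = beta a b * (b / (a + b)) := by
  have h1 : a + b ≠ 0 := by positivity
  have h2 : Real.Gamma (a + b) ≠ 0 := (Real.Gamma_pos_of_pos (by positivity)).ne'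
  rw [beta, beta, Real.Gamma_add_one hb.ne', show a + (b + 1) = a + b + 1 by ring,
    Real.Gamma_add_one h1]
  field_simp

theorem lintegral_beta {a b : ℝ} (ha : 0 < a) (hb : 0 < b) :
    ∫⁻ x in Set.Ioo (0 : ℝ) 1, ENNReal.ofReal (x ^ (a - 1) * (1 - x) ^ (b - 1)) =
      ENNReal.ofReal (beta a b) := by
  have h := lintegral_betaPDF_eq_one ha hb
  have hB := beta_pos ha hb
  rw [lintegral_betaPDF] at h
  have h2 : ∀ x : ℝ, ENNReal.ofReal (x ^ (a - 1) * (1 - x) ^ (b - 1)) = ENNReal.ofReal (beta a b) *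
      ENNReal.ofReal (1 / beta a b * x ^ (a - 1) * (1 - x) ^ (b - 1)) := by
    intro x
    rw [← ENNReal.ofReal_mul hB.le]
    congr 1
    field_simp
  simp_rw [h2]
  rw [lintegral_const_mul _ (by fun_prop), h, mul_one]

theorem beta_integrand_nonneg (a b : ℝ) {x : ℝ} (hx : x ∈ Set.Ioo (0 : ℝ) 1) :
    0 ≤ x ^ (a - 1) * (1 - x) ^ (b - 1) :=
  mul_nonneg (Real.rpow_nonneg hx.1.le _) (Real.rpow_nonneg (by linarith [hx.2]) _)

theorem integrableOn_beta {a b : ℝ} (ha : 0 < a) (hb : 0 < b) :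
    IntegrableOn (fun x : ℝ => x ^ (a - 1) * (1 - x) ^ (b - 1)) (Set.Ioo 0 1) := by
  refine ⟨Measurable.aestronglyMeasurable (by fun_prop), ?_⟩
  rw [hasFiniteIntegral_iff_ofReal (ae_restrict_of_forall_mem measurableSet_Ioo
    fun x hx => beta_integrand_nonneg a b hx), lintegral_beta ha hb]
  exact ENNReal.ofReal_lt_top

theorem integral_beta {a b : ℝ} (ha : 0 < a) (hb : 0 < b) :
    ∫ x in Set.Ioo (0 : ℝ) 1, x ^ (a - 1) * (1 - x) ^ (b - 1) = beta a b := by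
  rw [integral_eq_lintegral_of_nonneg_ae (ae_restrict_of_forall_mem measurableSet_Ioo
    fun x hx => beta_integrand_nonneg a b hx) (Measurable.aestronglyMeasurable (by fun_prop)),
    lintegral_beta ha hb, ENNReal.toReal_ofReal (beta_pos ha hb).le]

/-! ### The total mass of `h` -/

section mass

variable {a b p q r : ℝ}

/-- The ratio of consecutive terms is `1 - (1 + s)/n + O(1/n²)` with `s = r + b - p - q`, so `s > 0`
is what Raabe's test needs. Half of `s` is spent on the lower-order terms. -/
theorem coef_mul_beta_raabe (hr : ∀ n : ℕ, r ≠ -(n : ℝ)) (ha : 0 < a) (hb : 0 < b)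
    (hs : 0 < r + b - p - q) :
    Summable (fun n : ℕ => |coef p q r n| * beta (a + n) b) ∧
      Tendsto (fun n : ℕ => (n : ℝ) * (|coef p q r n| * beta (a + n) b)) atTop (𝓝 0) := by
  have hB : ∀ n : ℕ, 0 < beta (a + n) b := fun n => beta_pos (by positivity) hb
  refine summable_of_raabe (δ := (r + b - p - q) / 2)
    (fun n => mul_nonneg (abs_nonneg _) (hB n).le) (by linarith) ?_
  set δ := (r + b - p - q) / 2 with hδ
  have hδ0 : 0 < δ := by rw [hδ]; linarith
  filter_upwards [eventually_pos_add p, eventually_pos_add q, eventually_pos_add r,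
    eventually_quadratic_nonneg hδ0
      (r * (a + b) - δ * (r + a + b) - (p * q + p * a + q * a)) (-δ * r * (a + b) - p * q * a)]
    with n hp hq hrn hn
  have h2 : (0 : ℝ) < n + 1 := by positivity
  have h3 : 0 < a + n := by positivity
  have h4 : 0 < a + n + b := by positivity
  push_cast
  rw [coef_succ_eq hr, abs_mul, abs_of_nonneg (a := (p + n) * (q + n) / ((n + 1) * (r + n)))
    (by positivity), ← add_assoc, beta_succ_left h3 hb]
  have key : (n + 1) * ((p + n) * (q + n) / ((n + 1) * (r + n))) * ((a + n) / (a + n + b)) ≤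
      n - δ := by
    rw [show (n + 1) * ((p + n) * (q + n) / ((n + 1) * (r + n))) * ((a + n) / (a + n + b)) =
      ((p + n) * (q + n) * (a + n)) / ((r + n) * (a + n + b)) by field_simp,
      div_le_iff₀ (by positivity)]
    have : (n - δ) * ((r + n) * (a + n + b)) - (p + n) * (q + n) * (a + n) =
      (r + b - p - q - δ) * (n : ℝ) ^ 2 +
      (r * (a + b) - δ * (r + a + b) - (p * q + p * a + q * a)) * n +
      (-δ * r * (a + b) - p * q * a) := by ring
    rw [show r + b - p - q - δ = δ by rw [hδ]; ring] at this
    linarith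
  calc _ = ((n + 1) * ((p + n) * (q + n) / ((n + 1) * (r + n))) * ((a + n) / (a + n + b))) *
        (|coef p q r n| * beta (a + n) b) := by ring
    _ ≤ _ := by
      gcongr
      exact mul_nonneg (abs_nonneg _) (hB n).le

/-- The `n`-th term of the expansion of `h` on `(0,1)`. -/
theorem h_term (a b : ℝ) (n : ℕ) {x c : ℝ} (hx : 0 < x) :
    x ^ (a - 1) * (1 - x) ^ (b - 1) * (c * x ^ n) =
      c * (x ^ (a + n - 1) * (1 - x) ^ (b - 1)) := by
  rw [show a + n - 1 = a - 1 + n by ring, Real.rpow_add hx, Real.rpow_natCast]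
  ring

theorem hasSum_h (hr : ∀ n : ℕ, r ≠ -(n : ℝ)) {x : ℝ} (hx : x ∈ Set.Ioo (0 : ℝ) 1) :
    HasSum (fun n : ℕ => coef p q r n * (x ^ (a + n - 1) * (1 - x) ^ (b - 1))) (h a b p q r x) := by
  have hx' : |x| < 1 := abs_lt.2 ⟨by linarith [hx.1], hx.2⟩
  have := (hasSum_hyp (p := p) (q := q) hr hx').mul_left (x ^ (a - 1) * (1 - x) ^ (b - 1))
  simp only [h_term a b _ hx.1] at this
  exact this

theorem integral_norm_term (ha : 0 < a) (hb : 0 < b) (n : ℕ) :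
    ∫ x in Set.Ioo (0 : ℝ) 1, ‖coef p q r n * (x ^ (a + n - 1) * (1 - x) ^ (b - 1))‖ =
      |coef p q r n| * beta (a + n) b := by
  rw [← integral_beta (by positivity) hb, ← integral_const_mul]
  refine setIntegral_congr_fun measurableSet_Ioo fun x hx => ?_
  simp only [norm_mul, Real.norm_eq_abs]
  rw [← abs_mul (x ^ _), abs_of_nonneg (beta_integrand_nonneg (a + n) b hx)]

theorem hasSum_integral_h (hr : ∀ n : ℕ, r ≠ -(n : ℝ)) (ha : 0 < a) (hb : 0 < b)
    (hs : 0 < r + b - p - q) :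
    HasSum (fun n : ℕ => coef p q r n * beta (a + n) b)
      (∫ x in Set.Ioo (0 : ℝ) 1, h a b p q r x) := by
  have h1 := hasSum_integral_of_summable_integral_norm
    (μ := volume.restrict (Set.Ioo (0 : ℝ) 1))
    (F := fun (n : ℕ) (x : ℝ) => coef p q r n * (x ^ (a + n - 1) * (1 - x) ^ (b - 1)))
    (fun n => (integrableOn_beta (by positivity) hb).const_mul _)
    (by simpa only [integral_norm_term ha hb] using (coef_mul_beta_raabe hr ha hb hs).1)
  rw [setIntegral_congr_fun measurableSet_Ioo fun x hx =>
    (hasSum_h (a := a) (b := b) (p := p) (q := q) hr hx).tsum_eq] at h1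
  refine h1.congr_fun fun n => ?_
  rw [integral_const_mul, integral_beta (by positivity) hb]

theorem measurable_h (a b p q r : ℝ) : Measurable (h a b p q r) := by
  have := measurable_hyp p q r
  unfold h
  fun_prop

theorem integrableOn_h (hr : ∀ n : ℕ, r ≠ -(n : ℝ)) (ha : 0 < a) (hb : 0 < b)
    (hs : 0 < r + b - p - q) : IntegrableOn (h a b p q r) (Set.Ioo 0 1) := by
  refine ⟨(measurable_h a b p q r).aestronglyMeasurable, ?_⟩
  have h1 : ∀ x ∈ Set.Ioo (0 : ℝ) 1, ‖h a b p q r x‖ₑ ≤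
      ∑' n : ℕ, ‖coef p q r n * (x ^ (a + n - 1) * (1 - x) ^ (b - 1))‖ₑ := by
    intro x hx
    rw [← (hasSum_h hr hx).tsum_eq]
    exact enorm_tsum_le_tsum_enorm
  refine (setLIntegral_mono' measurableSet_Ioo h1).trans_lt ?_
  rw [lintegral_tsum fun n => Measurable.aemeasurable (by fun_prop)]
  have h2 : ∀ n : ℕ, ∫⁻ x in Set.Ioo (0 : ℝ) 1,
      ‖coef p q r n * (x ^ (a + n - 1) * (1 - x) ^ (b - 1))‖ₑ =
      ENNReal.ofReal (|coef p q r n| * beta (a + n) b) := by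
    intro n
    rw [← integral_norm_term ha hb, ofReal_integral_norm_eq_lintegral_enorm]
    exact (integrableOn_beta (by positivity) hb).const_mul _
  simp_rw [h2]
  exact (coef_mul_beta_raabe hr ha hb hs).1.tsum_ofReal_lt_top

/-- The contiguity relation for the moments `∫ x^(r-1) (1-x)^(b-1) ₂F₁(p,q;r;x) dx`. -/
theorem integral_h_succ (hr : 0 < r) (hb : 0 < b) (hs : 0 < r + b - p - q) :
    (r + b - p) * (r + b - q) * ∫ x in Set.Ioo (0 : ℝ) 1, h r (b + 1) p q r x =
      b * (r + b - p - q) * ∫ x in Set.Ioo (0 : ℝ) 1, h r b p q r x := by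
  have hr' : ∀ n : ℕ, r ≠ -(n : ℝ) := fun n hn => by
    have : (0 : ℝ) ≤ n := n.cast_nonneg
    linarith
  have h1 := (hasSum_integral_h (p := p) (q := q) hr' hr hb hs).mul_left (b * (r + b - p - q))
  have h2 := (hasSum_integral_h (p := p) (q := q) (b := b + 1) hr' hr (by linarith) (by linarith)).mul_left
    ((r + b - p) * (r + b - q))
  have h3 := h2.sub h1
  have hlim : Tendsto (fun n : ℕ => (n : ℝ) * (coef p q r n * beta (r + n) b)) atTop (𝓝 0) := by
    refine squeeze_zero_norm (fun n => le_of_eq ?_) (coef_mul_beta_raabe hr' hr hb hs).2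
    rw [norm_mul, norm_mul, Real.norm_of_nonneg (n.cast_nonneg), Real.norm_eq_abs,
      Real.norm_of_nonneg (beta_pos (by positivity) hb).le]
  have h4 := h3.tendsto_sum_nat
  -- As the first parameter of `h` is `r`, the factor `r + n` of the beta ratio cancels the
  -- denominator in `coef_succ_eq`, and the difference of the two series telescopes. The remainder
  -- vanishes by `hlim`.
  have h5 : ∀ N : ℕ, ∑ n ∈ Finset.range N, ((r + b - p) * (r + b - q) *
      (coef p q r n * beta (r + n) (b + 1)) -
      b * (r + b - p - q) * (coef p q r n * beta (r + n) b)) =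
      b * (N * (coef p q r N * beta (r + N) b)) := by
    intro N
    induction N with
    | zero => simp
    | succ n ih =>
      have hn : 0 < r + n := by positivity
      have hn2 : r + n + b ≠ 0 := by positivity
      have hn3 : (n : ℝ) + 1 ≠ 0 := by positivity
      rw [Finset.sum_range_succ, ih, coef_succ_eq hr']
      push_cast
      rw [← add_assoc, beta_succ_left hn hb, beta_succ_right hn hb]
      field_simp
      ring
  simp_rw [h5] at h4
  have := tendsto_nhds_unique h4 (hlim.const_mul b)
  linarith

end mass

theorem ne_neg_natCast {r : ℝ} (hr : 0 < r) (n : ℕ) : r ≠ -(n : ℝ) := by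
  have : (0 : ℝ) ≤ n := n.cast_nonneg
  intro hn
  linarith

/-! ### One step: the law of `1 / (1 + W X)` -/

section step

variable {a b p q r c d : ℝ}

theorem h_pos (h0 : Admissible a b p q r) (a' b' : ℝ) {x : ℝ} (hx : x ∈ Set.Ioo (0 : ℝ) 1) :
    0 < h a' b' p q r x :=
  mul_pos (mul_pos (Real.rpow_pos_of_pos hx.1 _) (Real.rpow_pos_of_pos (by linarith [hx.2]) _))
    (h0.2.1 x hx)

theorem lintegral_h (h0 : Admissible a b p q r) {a' b' : ℝ} (ha : 0 < a') (hb : 0 < b')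
    (hs : 0 < r + b' - p - q) :
    ∫⁻ x in Set.Ioo (0 : ℝ) 1, ENNReal.ofReal (h a' b' p q r x) =
      ENNReal.ofReal (∫ x in Set.Ioo (0 : ℝ) 1, h a' b' p q r x) :=
  (ofReal_integral_eq_lintegral_ofReal (integrableOn_h h0.1 ha hb hs)
    (ae_restrict_of_forall_mem measurableSet_Ioo fun _ hx => (h_pos h0 _ _ hx).le)).symm

theorem integral_h_pos (h0 : Admissible a b p q r) {a' b' : ℝ} (ha : 0 < a') (hb : 0 < b')
    (hs : 0 < r + b' - p - q) : 0 < ∫ x in Set.Ioo (0 : ℝ) 1, h a' b' p q r x := by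
  rw [setIntegral_pos_iff_support_of_nonneg_ae (ae_restrict_of_forall_mem measurableSet_Ioo
    fun _ hx => (h_pos h0 _ _ hx).le) (integrableOn_h h0.1 ha hb hs)]
  have : Set.Ioo (0 : ℝ) 1 ⊆ Function.support (h a' b' p q r) ∩ Set.Ioo 0 1 :=
    fun x hx => ⟨(h_pos h0 _ _ hx).ne', hx⟩
  refine lt_of_lt_of_le ?_ (measure_mono this)
  simp

theorem unnormalizedBH_univ (a b p q r : ℝ) : unnormalizedBH a b p q r Set.univ =
    ∫⁻ x in Set.Ioo (0 : ℝ) 1, ENNReal.ofReal (h a b p q r x) := by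
  rw [unnormalizedBH, withDensity_apply _ MeasurableSet.univ, Measure.restrict_univ]

theorem isProbabilityMeasure_BH (h0 : Admissible a b p q r) :
    IsProbabilityMeasure (BH a b p q r) := by
  obtain ⟨-, -, ha, hb, hs⟩ := id h0
  constructor
  rw [BH, Measure.smul_apply, smul_eq_mul, unnormalizedBH_univ, lintegral_h h0 ha hb hs]
  exact ENNReal.inv_mul_cancel (by simpa using integral_h_pos h0 ha hb hs) ENNReal.ofReal_ne_top

theorem ae_mem_Ioo_BH (a b p q r : ℝ) : ∀ᵐ x ∂BH a b p q r, x ∈ Set.Ioo (0 : ℝ) 1 := by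
  refine Measure.ae_smul_measure ?_ _
  exact (withDensity_absolutelyContinuous _ _).ae_le (ae_restrict_mem measurableSet_Ioo)

theorem coef_one_one_nonneg {s : ℝ} (hs : 0 < s) (n : ℕ) : 0 ≤ coef s 1 1 n := by
  induction n with
  | zero => simp [coef_zero]
  | succ n ih => rw [coef_succ_eq one_ne_neg_nat]; positivity

/-- In `integral_h_succ` both integrals and the right-hand factors are positive, which forces the
sign. This makes `r + b - p` a legitimate lower parameter without assuming the target admissible. -/
theorem sub_pos_of_admissible (h0 : Admissible a b p q r) (hr : 0 < r) (hσ : 0 < r + b - q) :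
    0 < r + b - p := by
  obtain ⟨-, -, ha, hb, hs⟩ := id h0
  have h1 := integral_h_succ hr hb hs
  have h2 := integral_h_pos h0 hr hb hs
  have h3 := integral_h_pos h0 (b' := b + 1) hr (by linarith) (by linarith)
  have h4 := mul_pos (mul_pos hb hs) h2
  rw [← h1] at h4
  exact pos_of_mul_pos_left (pos_of_mul_pos_left h4 h3.le) hσ.le

/-- Contiguity at `b + n` has the factor `r + b - q + n`, which the binomial coefficient cancels;
what remains is the recursion of the coefficients on the right. -/
theorem coef_mul_integral_h (h0 : Admissible a b p q r) (hr : 0 < r) (hσ : 0 < r + b - q) (n : ℕ) :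
    coef (r + b - q) 1 1 n * ∫ x in Set.Ioo (0 : ℝ) 1, h r (b + n) p q r x =
      (∫ x in Set.Ioo (0 : ℝ) 1, h r b p q r x) * coef b (r + b - p - q) (r + b - p) n := by
  obtain ⟨-, -, ha, hb, hs⟩ := id h0
  have hM := integral_h_pos h0 hr hb hs
  have hp := sub_pos_of_admissible h0 hr hσ
  rw [← coef_unique (ne_neg_natCast hp) (f := fun n : ℕ => coef (r + b - q) 1 1 n *
    (∫ x in Set.Ioo (0 : ℝ) 1, h r (b + n) p q r x) / ∫ x in Set.Ioo (0 : ℝ) 1, h r b p q r x)]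
  · field_simp
  · simp [coef_zero, hM.ne']
  · intro n
    have h1 := integral_h_succ (p := p) (q := q) (b := b + n) hr (by positivity)
      (by have : (0 : ℝ) ≤ n := n.cast_nonneg
          linarith)
    have h2 : (1 + n : ℝ) ≠ 0 := by positivity
    have h3 : ((n : ℝ) + 1) ≠ 0 := by positivity
    rw [coef_succ_eq one_ne_neg_nat]
    push_cast
    rw [← add_assoc]
    field_simp
    linear_combination coef (r + b - q) 1 1 n * h1

/-- The integral over `x` in the density of `1 / (1 + W X)` at `y`. -/
theorem lintegral_kernel (h0 : Admissible a b p q r) (hr : 0 < r) (hσ : 0 < r + b - q) {y : ℝ}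
    (hy : y ∈ Set.Ioo (0 : ℝ) 1) :
    ∫⁻ x in Set.Ioo (0 : ℝ) 1,
        ENNReal.ofReal (h r b p q r x * (1 - y * (1 - x)) ^ (-(r + b - q))) =
      ENNReal.ofReal ((∫ x in Set.Ioo (0 : ℝ) 1, h r b p q r x) *
        ordinaryHypergeometric b (r + b - p - q) (r + b - p) y) := by
  obtain ⟨-, -, ha, hb, hs⟩ := id h0
  have hp := sub_pos_of_admissible h0 hr hσ
  have hcn := coef_one_one_nonneg hσ
  -- Binomial expansion in `y (1 - x)`; the powers of `1 - x` shift `b` to `b + n`. All terms are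
  -- nonnegative, so sum and integral may be exchanged.
  have hexp : ∀ x ∈ Set.Ioo (0 : ℝ) 1,
      ENNReal.ofReal (h r b p q r x * (1 - y * (1 - x)) ^ (-(r + b - q))) =
      ∑' n : ℕ, ENNReal.ofReal (coef (r + b - q) 1 1 n * y ^ n) *
        ENNReal.ofReal (h r (b + n) p q r x) := by
    intro x hx
    have hx1 : 0 < 1 - x := by linarith [hx.2]
    have hz0 : 0 < y * (1 - x) := mul_pos hy.1 hx1
    have hz1 : y * (1 - x) < 1 := by nlinarith [hx.1, hy.1, hy.2]
    have hz : |y * (1 - x)| < 1 := by rwa [abs_of_pos hz0]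
    have hsum := (hasSum_hyp (p := r + b - q) (q := 1) one_ne_neg_nat hz).mul_left (h r b p q r x)
    rw [hyp_one_one _ hz] at hsum
    have hterm : ∀ n : ℕ, h r b p q r x * (coef (r + b - q) 1 1 n * (y * (1 - x)) ^ n) =
        coef (r + b - q) 1 1 n * y ^ n * h r (b + n) p q r x := by
      intro n
      rw [h, h, show b + n - 1 = b - 1 + n by ring, Real.rpow_add hx1, Real.rpow_natCast, mul_pow]
      ring
    simp_rw [hterm] at hsum
    have hnn : ∀ n : ℕ, 0 ≤ coef (r + b - q) 1 1 n * y ^ n := fun n =>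
      mul_nonneg (hcn n) (pow_nonneg hy.1.le n)
    rw [← hsum.tsum_eq, ENNReal.ofReal_tsum_of_nonneg
      (fun n => mul_nonneg (hnn n) (h_pos h0 _ _ hx).le) hsum.summable]
    exact tsum_congr fun n => ENNReal.ofReal_mul (hnn n)
  have hyabs : |y| < 1 := abs_lt.2 ⟨by linarith [hy.1], hy.2⟩
  have hsum := (hasSum_hyp (p := b) (q := r + b - p - q) (ne_neg_natCast hp) hyabs).mul_left
    (∫ x in Set.Ioo (0 : ℝ) 1, h r b p q r x)
  have hb' : ∀ n : ℕ, 0 < b + n := fun n => by positivity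
  have hs' : ∀ n : ℕ, 0 < r + (b + n) - p - q := fun n => by
    have : (0 : ℝ) ≤ n := n.cast_nonneg
    linarith
  have hterm : ∀ n : ℕ, (∫ x in Set.Ioo (0 : ℝ) 1, h r b p q r x) *
      (coef b (r + b - p - q) (r + b - p) n * y ^ n) = coef (r + b - q) 1 1 n * y ^ n *
        ∫ x in Set.Ioo (0 : ℝ) 1, h r (b + n) p q r x := by
    intro n
    rw [← mul_assoc, ← coef_mul_integral_h h0 hr hσ]
    ring
  simp_rw [hterm] at hsum
  have hnn : ∀ n : ℕ, 0 ≤ coef (r + b - q) 1 1 n * y ^ n := fun n =>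
    mul_nonneg (hcn n) (pow_nonneg hy.1.le n)
  rw [setLIntegral_congr_fun measurableSet_Ioo hexp, lintegral_tsum fun n =>
    ((measurable_h _ _ _ _ _).ennreal_ofReal.const_mul _).aemeasurable, ← hsum.tsum_eq,
    ENNReal.ofReal_tsum_of_nonneg (fun n => mul_nonneg (hnn n)
      (integral_h_pos h0 hr (hb' n) (hs' n)).le) hsum.summable]
  refine tsum_congr fun n => ?_
  rw [lintegral_const_mul _ (measurable_h _ _ _ _ _).ennreal_ofReal,
    lintegral_h h0 hr (hb' n) (hs' n), ENNReal.ofReal_mul (hnn n)]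

/-- The law of `1 / (1 + W x)` for fixed `x ∈ (0,1)`. -/
theorem lintegral_moebius (c d : ℝ) {x : ℝ} (hx : x ∈ Set.Ioo (0 : ℝ) 1) (φ : ℝ → ENNReal) :
    ∫⁻ w in Set.Ioi (0 : ℝ), ENNReal.ofReal
        (1 / beta c d * (w ^ (c - 1) / (1 + w) ^ (c + d))) * φ (moebius w x) =
      ∫⁻ y in Set.Ioo (0 : ℝ) 1, ENNReal.ofReal (1 / beta c d *
        (y ^ (d - 1) * (1 - y) ^ (c - 1) * (x ^ d * (1 - y * (1 - x)) ^ (-(c + d))))) * φ y := by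
  have hx0 := hx.1
  -- `ψ` inverts `w ↦ moebius w x`; it serves as change of variables from `(0,1)` onto `(0,∞)`.
  set ψ : ℝ → ℝ := fun y => (y⁻¹ - 1) / x with hψ
  have himg : ψ '' Set.Ioo 0 1 = Set.Ioi 0 := by
    ext w
    constructor
    · rintro ⟨y, hy, rfl⟩
      exact div_pos (by linarith [(one_lt_inv₀ hy.1).2 hy.2]) hx0
    · intro hw
      have hw' : 0 < w := hw
      have hwx : 0 < w * x := mul_pos hw' hx0
      refine ⟨1 / (1 + w * x), ⟨by positivity, ?_⟩, ?_⟩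
      · rw [div_lt_one (by positivity)]; linarith
      · simp only [hψ]; field_simp; ring
  have hder : ∀ y ∈ Set.Ioo (0 : ℝ) 1,
      HasDerivWithinAt ψ (-(y ^ 2)⁻¹ / x) (Set.Ioo 0 1) y := fun y hy =>
    (((hasDerivAt_inv hy.1.ne').sub_const 1).div_const x).hasDerivWithinAt
  have hinj : Set.InjOn ψ (Set.Ioo 0 1) := by
    intro y hy z hz hyz
    simp only [hψ] at hyz
    have := (div_left_inj' hx0.ne').1 hyz
    exact inv_injective (by linarith)
  rw [← himg, lintegral_image_eq_lintegral_abs_deriv_mul measurableSet_Ioo hder hinj]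
  refine setLIntegral_congr_fun measurableSet_Ioo fun y hy => ?_
  have hy0 := hy.1
  have hy1 : 0 < 1 - y := by linarith [hy.2]
  have hm : moebius (ψ y) x = y := by
    simp only [moebius, hψ]
    field_simp
    ring
  have hpos : 0 < 1 - y * (1 - x) := by nlinarith [mul_pos hy0 hx0]
  have h1 : ψ y = (1 - y) / (x * y) := by
    simp only [hψ]; field_simp
  have h2 : 1 + ψ y = (1 - y * (1 - x)) / (x * y) := by
    rw [h1]; field_simp; ring
  have hxy : 0 < x * y := mul_pos hx0 hy0
  simp only [hm]
  rw [← mul_assoc, ← ENNReal.ofReal_mul (abs_nonneg _), h2, h1, abs_div, abs_neg,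
    abs_of_pos hx0, abs_of_pos (a := (y ^ 2)⁻¹) (by positivity),
    Real.div_rpow hy1.le hxy.le, Real.div_rpow hpos.le hxy.le]
  congr 2
  rw [Real.rpow_neg hpos.le]
  -- The part `c - 1` cancels against the power of `ψ y`; the factor `x * y` meets the Jacobian `1 /
  -- (x y²)`.
  have e1 : (x * y) ^ (c + d) = (x * y) ^ (c - 1) * (x * y) * (x ^ d * y ^ d) := by
    rw [← Real.mul_rpow hx0.le hy0.le, ← Real.rpow_add_one hxy.ne', ← Real.rpow_add hxy]
    congr 1; ring
  have e2 : y ^ d = y ^ (d - 1) * y := by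
    rw [← Real.rpow_add_one hy0.ne']; congr 1; ring
  rw [e1, e2]
  have p1 : (x * y) ^ (c - 1) ≠ 0 := (Real.rpow_pos_of_pos hxy _).ne'
  have p2 : (1 - y * (1 - x)) ^ (c + d) ≠ 0 := (Real.rpow_pos_of_pos hpos _).ne'
  generalize (x * y) ^ (c - 1) = u at *
  field_simp

theorem measurable_moebius : Measurable fun z : ℝ × ℝ => moebius z.1 z.2 := by
  unfold moebius; fun_prop

theorem lintegral_unnormalizedBH (a b p q r : ℝ) {φ : ℝ → ENNReal} (hφ : Measurable φ) :
    ∫⁻ x, φ x ∂unnormalizedBH a b p q r =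
      ∫⁻ x in Set.Ioo (0 : ℝ) 1, ENNReal.ofReal (h a b p q r x) * φ x := by
  rw [unnormalizedBH, lintegral_withDensity_eq_lintegral_mul _
    (measurable_h a b p q r).ennreal_ofReal hφ]
  rfl

theorem lintegral_betaPrime (c d : ℝ) {φ : ℝ → ENNReal} (hφ : Measurable φ) :
    ∫⁻ w, φ w ∂betaPrime c d = ∫⁻ w in Set.Ioi (0 : ℝ), ENNReal.ofReal
      (1 / beta c d * (w ^ (c - 1) / (1 + w) ^ (c + d))) * φ w := by
  rw [betaPrime, lintegral_withDensity_eq_lintegral_mul _ (by fun_prop) hφ]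
  rfl

/-- After Tonelli, `r = a + d` merges `x^(a-1) x^d` into `x^(r-1)`, and `r + b - q = c + d` matches
the kernel exponent, so `lintegral_kernel` applies. -/
theorem lintegral_moebius_unnormalizedBH (h0 : Admissible a b p q r) (hc : 0 < c) (hd : 0 < d)
    (hr : r = a + d) (hσ : r + b - q = c + d) {φ : ℝ → ENNReal} (hφ : Measurable φ) :
    ∫⁻ x, ∫⁻ w, φ (moebius w x) ∂betaPrime c d ∂unnormalizedBH a b p q r =
      ENNReal.ofReal (1 / beta c d * ∫ x in Set.Ioo (0 : ℝ) 1, h r b p q r x) *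
        ∫⁻ y, φ y ∂unnormalizedBH d c b (r + b - p - q) (r + b - p) := by
  obtain ⟨-, -, ha, hb, hs⟩ := id h0
  have hr0 : 0 < r := by rw [hr]; positivity
  have hσ0 : 0 < r + b - q := by rw [hσ]; positivity
  have hB := beta_pos hc hd
  have hM := integral_h_pos h0 hr0 hb hs
  have hin : ∀ x ∈ Set.Ioo (0 : ℝ) 1, ENNReal.ofReal (h a b p q r x) *
      ∫⁻ w, φ (moebius w x) ∂betaPrime c d = ∫⁻ y in Set.Ioo (0 : ℝ) 1,
        ENNReal.ofReal (1 / beta c d * (y ^ (d - 1) * (1 - y) ^ (c - 1))) * φ y *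
        ENNReal.ofReal (h r b p q r x * (1 - y * (1 - x)) ^ (-(r + b - q))) := by
    intro x hx
    have hφx : Measurable fun w => φ (moebius w x) :=
      hφ.comp (measurable_moebius.comp measurable_prodMk_right)
    rw [lintegral_betaPrime c d hφx,
      lintegral_moebius c d hx, ← lintegral_const_mul _ (by fun_prop)]
    refine setLIntegral_congr_fun measurableSet_Ioo fun y hy => ?_
    have hy1 : 0 ≤ 1 / beta c d * (y ^ (d - 1) * (1 - y) ^ (c - 1)) :=
      mul_nonneg (by positivity) (beta_integrand_nonneg d c hy)
    have hx1 : h r b p q r x = h a b p q r x * x ^ d := by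
      rw [h, h, hr, show a + d - 1 = a - 1 + d by ring, Real.rpow_add hx.1]
      ring
    rw [← mul_assoc, ← ENNReal.ofReal_mul (h_pos h0 _ _ hx).le, mul_right_comm _ (φ y),
      ← ENNReal.ofReal_mul hy1, hx1, hσ]
    congr 2
    ring
  have : SFinite (betaPrime c d) := by unfold betaPrime; infer_instance
  have hout : Measurable fun x => ∫⁻ w, φ (moebius w x) ∂betaPrime c d :=
    Measurable.lintegral_prod_right' (f := fun z : ℝ × ℝ => φ (moebius z.2 z.1))
      (hφ.comp (measurable_moebius.comp measurable_swap))
  rw [lintegral_unnormalizedBH _ _ _ _ _ hout,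
    setLIntegral_congr_fun measurableSet_Ioo hin, lintegral_lintegral_swap
      (by have := measurable_h r b p q r; fun_prop),
    lintegral_unnormalizedBH _ _ _ _ _ hφ, ← lintegral_const_mul _
      (by have := measurable_h d c b (r + b - p - q) (r + b - p); fun_prop)]
  refine setLIntegral_congr_fun measurableSet_Ioo fun y hy => ?_
  have hy1 : 0 ≤ 1 / beta c d * (y ^ (d - 1) * (1 - y) ^ (c - 1)) :=
    mul_nonneg (by positivity) (beta_integrand_nonneg d c hy)
  rw [lintegral_const_mul _ (by have := measurable_h r b p q r; fun_prop),
    lintegral_kernel h0 hr0 hσ0 hy, mul_right_comm, ← ENNReal.ofReal_mul hy1,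
    ← mul_assoc (ENNReal.ofReal (1 / beta c d * _)), ← ENNReal.ofReal_mul (by positivity)]
  congr 2
  rw [h]
  ring

/-- If `X ∼ BH(a,b,p,q,r)` and `W ∼ β'(c,d)` are independent, then `1 / (1 + W X)` has again a beta
hypergeometric law. -/
theorem lintegral_moebius_BH (h0 : Admissible a b p q r) (hc : 0 < c) (hd : 0 < d)
    (hr : r = a + d) (hσ : r + b - q = c + d) [IsProbabilityMeasure (betaPrime c d)]
    {φ : ℝ → ENNReal} (hφ : Measurable φ) :
    ∫⁻ x, ∫⁻ w, φ (moebius w x) ∂betaPrime c d ∂BH a b p q r =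
      ∫⁻ y, φ y ∂BH d c b (r + b - p - q) (r + b - p) := by
  have := isProbabilityMeasure_BH h0
  have key : ∀ {φ : ℝ → ENNReal}, Measurable φ →
      ∫⁻ x, ∫⁻ w, φ (moebius w x) ∂betaPrime c d ∂BH a b p q r =
      (unnormalizedBH a b p q r Set.univ)⁻¹ *
        ENNReal.ofReal (1 / beta c d * ∫ x in Set.Ioo (0 : ℝ) 1, h r b p q r x) *
        ∫⁻ y, φ y ∂unnormalizedBH d c b (r + b - p - q) (r + b - p) := by
    intro φ hφ
    rw [BH, lintegral_smul_measure, lintegral_moebius_unnormalizedBH h0 hc hd hr hσ hφ,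
      smul_eq_mul, mul_assoc]
  -- The left side has mass one, so `φ = 1` identifies the constant as the inverse mass of the
  -- target; no closed form is needed.
  have h1 := key (φ := fun _ => 1) measurable_const
  simp only [lintegral_const, measure_univ, mul_one, one_mul] at h1
  rw [key hφ, BH, lintegral_smul_measure, smul_eq_mul,
    ENNReal.eq_inv_of_mul_eq_one_left h1.symm]

end step

/-! ### Dependence on the triple only -/

theorem BH_congr {a b p q r a' b' p' q' r' : ℝ}
    (heq : ∀ x ∈ Set.Ioo (0 : ℝ) 1, h a b p q r x = h a' b' p' q' r' x) :
    BH a b p q r = BH a' b' p' q' r' := by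
  have : unnormalizedBH a b p q r = unnormalizedBH a' b' p' q' r' := by
    refine withDensity_congr_ae (ae_restrict_of_forall_mem measurableSet_Ioo fun x hx => ?_)
    simp only [heq x hx]
  rw [BH, BH, this]

theorem Admissible.comm {a b p q r : ℝ} (h0 : Admissible a b p q r) : Admissible a b q p r :=
  ⟨h0.1, fun x hx => by rw [hyp_comm]; exact h0.2.1 x hx, h0.2.2.1, h0.2.2.2.1,
    by linarith [h0.2.2.2.2]⟩

theorem BH_comm (a b p q r : ℝ) : BH a b p q r = BH a b q p r :=
  BH_congr fun x _ => by rw [h, h, hyp_comm]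

theorem abs_lt_one_of_mem {x : ℝ} (hx : x ∈ Set.Ioo (0 : ℝ) 1) : |x| < 1 :=
  abs_lt.2 ⟨by linarith [hx.1], hx.2⟩

/-- Euler's transformation exchanges `b` and `r + b - p - q`. -/
theorem Admissible.euler {a b p q r : ℝ} (h0 : Admissible a b p q r) :
    Admissible a (r + b - p - q) (r - p) (r - q) r := by
  obtain ⟨hr, hF, ha, hb, hs⟩ := h0
  refine ⟨hr, fun x hx => ?_, ha, hs, by linarith⟩
  have := hF x hx
  rw [hyp_euler hr (abs_lt_one_of_mem hx)] at this
  exact pos_of_mul_pos_right this (Real.rpow_nonneg (by linarith [hx.2]) _)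

theorem BH_euler {a b p q r : ℝ} (hr : ∀ n : ℕ, r ≠ -(n : ℝ)) :
    BH a b p q r = BH a (r + b - p - q) (r - p) (r - q) r := by
  refine BH_congr fun x hx => ?_
  rw [h, h, hyp_euler hr (abs_lt_one_of_mem hx),
    show r + b - p - q - 1 = b - 1 + (r - p - q) by ring,
    Real.rpow_add (by linarith [hx.2])]
  ring

/-- Swapping `θ 3, θ 4` swaps `p, q`. Swapping `θ 1, θ 2` is Euler's transformation followed by a
swap of `p, q`; for both swaps together Euler's transformation alone remains. -/
theorem thetaAdmissible_and_BHθ_eq_of_triple_eq {θ θ' : Fin 5 → ℝ} (ht : triple θ = triple θ')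
    (h0 : ThetaAdmissible θ) : ThetaAdmissible θ' ∧ BHθ θ = BHθ θ' := by
  simp only [triple, Prod.mk.injEq, Sym2.eq_iff] at ht
  obtain ⟨e0, h12, h34⟩ := ht
  unfold ThetaAdmissible BHθ at *
  have hE := h0.euler
  have hE' := BH_euler (a := θ 3 + θ 4) (b := θ 0 + θ 2) (p := θ 2 + θ 4) (q := θ 2 + θ 3) h0.1
  rcases h12 with ⟨e1, e2⟩ | ⟨e1, e2⟩ <;> rcases h34 with ⟨e3, e4⟩ | ⟨e3, e4⟩
  · rw [← e0, ← e1, ← e2, ← e3, ← e4]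
    exact ⟨h0, rfl⟩
  · constructor
    · convert h0.comm using 1 <;> linarith
    · rw [BH_comm]
      congr 1 <;> linarith
  · constructor
    · convert hE.comm using 1 <;> linarith
    · rw [hE', BH_comm]
      congr 1 <;> linarith
  · constructor
    · convert hE using 1 <;> linarith
    · rw [hE']
      congr 1 <;> linarith

/-! ### Convergence of the continued fraction -/

theorem moebius_mem_Icc {w x : ℝ} (hw : 0 ≤ w) (hx : 0 ≤ x) :
    moebius w x ∈ Set.Icc (0 : ℝ) 1 := by
  have : 0 ≤ w * x := mul_nonneg hw hx
  refine ⟨by unfold moebius; positivity, ?_⟩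
  rw [moebius, div_le_one (by positivity)]
  linarith

/-- Moebius maps contract relative distances on `[0,1]`. -/
theorem moebius_contract {w x y ρ : ℝ} (hw : 0 ≤ w) (hρ : 0 ≤ ρ) (hx : x ∈ Set.Icc (0 : ℝ) 1)
    (hy : y ∈ Set.Icc (0 : ℝ) 1) (h : |x - y| ≤ ρ * max x y) :
    |moebius w x - moebius w y| ≤ ρ * (w / (1 + w)) * max (moebius w x) (moebius w y) := by
  wlog hxy : x ≤ y generalizing x y
  · rw [abs_sub_comm, max_comm]
    exact this hy hx (by rwa [abs_sub_comm, max_comm]) (le_of_not_ge hxy)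
  have hwx : 0 ≤ w * x := mul_nonneg hw hx.1
  have hwy : 0 ≤ w * y := mul_nonneg hw hy.1
  have hle : moebius w y ≤ moebius w x := by
    unfold moebius
    gcongr
  rw [max_eq_right hxy, abs_sub_comm, abs_of_nonneg (sub_nonneg.2 hxy)] at h
  rw [abs_of_nonneg (sub_nonneg.2 hle), max_eq_left hle]
  -- The map is decreasing, so `moebius w x` is the larger image. Its coefficient is bounded through
  -- `y - x ≤ ρ y` and `y ≤ 1`.
  have e : moebius w x - moebius w y = w * (y - x) / (1 + w * y) * moebius w x := by
    unfold moebius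
    field_simp
    ring
  rw [e]
  refine mul_le_mul_of_nonneg_right ?_ (moebius_mem_Icc hw hx.1).1
  calc w * (y - x) / (1 + w * y) ≤ w * (ρ * y) / (1 + w * y) := by gcongr
    _ = ρ * (w * y / (1 + w * y)) := by ring
    _ ≤ ρ * (w / (1 + w)) := by
      gcongr ρ * ?_
      rw [div_le_div_iff₀ (by positivity) (by positivity)]
      nlinarith [mul_le_mul_of_nonneg_left hy.2 hw]

/-- A bound for the oscillation of `Z w n` on `[0,1]`. -/
def osc (w : ℕ → ℝ) (n : ℕ) : ℝ := ∏ k ∈ Finset.range n, w k / (1 + w k)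

/-- Relative distances are tracked because absolute ones need not shrink: `moebius w` has slope `-w`
at `0`. The induction carries a general `ρ`, as each new map is innermost. -/
theorem abs_Z_sub_Z_le {w : ℕ → ℝ} (hw : ∀ k, 0 ≤ w k) (n : ℕ) {x y : ℝ}
    (hx : x ∈ Set.Icc (0 : ℝ) 1) (hy : y ∈ Set.Icc (0 : ℝ) 1) :
    |Z w n x - Z w n y| ≤ osc w n := by
  suffices H : ∀ (n : ℕ) (x y ρ : ℝ), x ∈ Set.Icc (0 : ℝ) 1 → y ∈ Set.Icc (0 : ℝ) 1 → 0 ≤ ρ →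
      |x - y| ≤ ρ * max x y → |Z w n x - Z w n y| ≤ ρ * osc w n by
    have := H n x y 1 hx hy zero_le_one (by
      rw [one_mul, abs_le]
      constructor <;> linarith [le_max_left x y, le_max_right x y, hx.1, hy.1])
    rwa [one_mul] at this
  intro n
  induction n with
  | zero =>
    intro x y ρ hx hy hρ h
    simp only [Z, osc, Finset.range_zero, Finset.prod_empty]
    exact h.trans (mul_le_mul_of_nonneg_left (max_le hx.2 hy.2) hρ)
  | succ n ih =>
    intro x y ρ hx hy hρ h
    have := ih _ _ _ (moebius_mem_Icc (hw n) hx.1) (moebius_mem_Icc (hw n) hy.1)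
      (mul_nonneg hρ (div_nonneg (hw n) (by linarith [hw n]))) (moebius_contract (hw n) hρ hx hy h)
    rw [osc, Finset.prod_range_succ, ← osc]
    simp only [Z]
    linarith

theorem Z_add (w : ℕ → ℝ) (n m : ℕ) (x : ℝ) :
    Z w (n + m) x = Z w n (Z (fun k => w (n + k)) m x) := by
  induction m generalizing x with
  | zero => rfl
  | succ m ih => exact ih _

theorem Z_mem_Icc {w : ℕ → ℝ} (hw : ∀ k, 0 ≤ w k) (n : ℕ) {x : ℝ} (hx : x ∈ Set.Icc (0 : ℝ) 1) :
    Z w n x ∈ Set.Icc (0 : ℝ) 1 := by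
  induction n generalizing x with
  | zero => exact hx
  | succ n ih => exact ih (moebius_mem_Icc (hw n) hx.1)

/-- The product decreases, and each factor with `w k ≤ 1` at least halves it, so its limit satisfies
`L ≤ L / 2`. -/
theorem osc_tendsto_zero {w : ℕ → ℝ} (hw : ∀ k, 0 < w k) (hf : ∃ᶠ k in atTop, w k ≤ 1) :
    Tendsto (osc w) atTop (𝓝 0) := by
  have hpos : ∀ n, 0 < osc w n := fun n => Finset.prod_pos fun k _ => by
    have := hw k
    positivity
  have hsucc : ∀ n, osc w (n + 1) = osc w n * (w n / (1 + w n)) := fun n => by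
    rw [osc, Finset.prod_range_succ, ← osc]
  have hanti : Antitone (osc w) := antitone_nat_of_succ_le fun n => by
    rw [hsucc]
    have := hw n
    refine mul_le_of_le_one_right (hpos n).le ?_
    rw [div_le_one (by positivity)]
    linarith
  have hlim := tendsto_atTop_ciInf hanti ⟨0, by rintro _ ⟨n, rfl⟩; exact (hpos n).le⟩
  set L := ⨅ n, osc w n
  have hL : 0 ≤ L := le_ciInf fun n => (hpos n).le
  have h2 : ∃ᶠ n in atTop, osc w (n + 1) ≤ osc w n / 2 := hf.mono fun n hn => by
    have := hw n
    rw [hsucc, div_eq_mul_one_div (osc w n)]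
    refine mul_le_mul_of_nonneg_left ?_ (hpos n).le
    rw [div_le_div_iff₀ (by positivity) two_pos]
    linarith
  have h3 : L ≤ L / 2 :=
    le_of_tendsto_of_tendsto_of_frequently ((tendsto_add_atTop_iff_nat 1).2 hlim)
      (hlim.div_const 2) h2
  have : L = 0 := by linarith
  rwa [this] at hlim

theorem exists_tendsto_Z {w : ℕ → ℝ} (hw : ∀ k, 0 < w k) (hf : ∃ᶠ k in atTop, w k ≤ 1) :
    ∃ L, ∀ x, 0 ≤ x → Tendsto (fun n => Z w n x) atTop (𝓝 L) := by
  have hw' : ∀ k, 0 ≤ w k := fun k => (hw k).le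
  have h0 : (0 : ℝ) ∈ Set.Icc (0 : ℝ) 1 := ⟨le_rfl, zero_le_one⟩
  have hosc := osc_tendsto_zero hw hf
  have hc : CauchySeq fun n => Z w n 0 := by
    refine cauchySeq_of_le_tendsto_0' (osc w) (fun n m hnm => ?_) hosc
    obtain ⟨k, rfl⟩ := Nat.exists_eq_add_of_le hnm
    rw [Z_add, Real.dist_eq]
    exact abs_Z_sub_Z_le hw' n h0 (Z_mem_Icc (fun _ => hw' _) _ h0)
  obtain ⟨L, hL⟩ := cauchySeq_tendsto_of_complete hc
  refine ⟨L, fun x hx => ?_⟩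
  -- After the shift the innermost map sends `x ≥ 0` into `[0,1]`, where `osc` controls the
  -- distance.
  rw [← tendsto_add_atTop_iff_nat 1]
  have h1 : Tendsto (fun n => Z w (n + 1) x - Z w n 0) atTop (𝓝 0) :=
    squeeze_zero_norm (fun n => abs_Z_sub_Z_le hw' n (moebius_mem_Icc (hw' n) hx) h0) hosc
  simpa using h1.add hL

/-! ### Random continued fractions -/

section probability

variable {Ω : Type*} [MeasurableSpace Ω] {P : Measure Ω}

theorem measurable_Z (n : ℕ) : Measurable fun z : (ℕ → ℝ) × ℝ => Z z.1 n z.2 := by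
  induction n with
  | zero => exact measurable_snd
  | succ n ih =>
    have : Measurable fun z : (ℕ → ℝ) × ℝ => (z.1, moebius (z.1 n) z.2) := by
      unfold moebius; fun_prop
    exact ih.comp this

theorem Z_congr {w w' : ℕ → ℝ} {n : ℕ} (hw : ∀ k < n, w k = w' k) (x : ℝ) :
    Z w n x = Z w' n x := by
  induction n generalizing x with
  | zero => rfl
  | succ n ih =>
    simp only [Z, hw n n.lt_succ_self]
    exact ih (fun k hk => hw k (hk.trans n.lt_succ_self)) _

/-- Truncated sequences are independent of the next variable. -/
theorem indepFun_truncate {W : ℕ → Ω → ℝ} (hW : ∀ n, Measurable (W n)) (hind : iIndepFun W P)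
    (n : ℕ) : IndepFun (fun ω k => if k < n then W k ω else 0) (W n) P := by
  have h := hind.indepFun_finset (Finset.range n) {n} (by simp) hW
  have h1 : Measurable fun (g : (Finset.range n) → ℝ) (k : ℕ) =>
      if hk : k ∈ Finset.range n then g ⟨k, hk⟩ else 0 := by
    refine measurable_pi_lambda _ fun k => ?_
    by_cases hk : k ∈ Finset.range n
    · simp only [hk, dite_true]; fun_prop
    · simp only [hk, dite_false]; fun_prop
  have h2 : Measurable fun g : ({n} : Finset ℕ) → ℝ => g ⟨n, Finset.mem_singleton_self n⟩ := by
    fun_prop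
  have := h.comp h1 h2
  convert this using 1
  ext ω k
  simp
  rfl

variable [IsProbabilityMeasure P]

theorem lintegral_of_indepFun {α β : Type*} [MeasurableSpace α] [MeasurableSpace β]
    {X : Ω → α} {Y : Ω → β} (hX : Measurable X) (hY : Measurable Y) (hXY : IndepFun X Y P)
    {F : α × β → ENNReal} (hF : Measurable F) :
    ∫⁻ ω, F (X ω, Y ω) ∂P = ∫⁻ ω, ∫⁻ y, F (X ω, y) ∂(P.map Y) ∂P := by
  have := Measure.isProbabilityMeasure_map (μ := P) hY.aemeasurable
  rw [← lintegral_map hF (hX.prodMk hY),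
    (indepFun_iff_map_prod_eq_prod_map_map hX.aemeasurable hY.aemeasurable).1 hXY,
    lintegral_prod _ hF.aemeasurable, lintegral_map hF.lintegral_prod_right' hX]

variable {μ β : ℕ → Measure ℝ} [∀ n, IsProbabilityMeasure (μ n)] {W : ℕ → Ω → ℝ}

/-- If the laws `μ n` are compatible with the random Moebius maps, then `Z n` transports `μ n`
to `μ 0`. -/
theorem lintegral_Z (hW : ∀ n, Measurable (W n)) (hind : iIndepFun W P)
    (hβ : ∀ n, P.map (W n) = β n)
    (hstep : ∀ n (φ : ℝ → ENNReal), Measurable φ →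
      ∫⁻ x, ∫⁻ w, φ (moebius w x) ∂β n ∂μ (n + 1) = ∫⁻ x, φ x ∂μ n)
    {φ : ℝ → ENNReal} (hφ : Measurable φ) (n : ℕ) :
    ∫⁻ ω, ∫⁻ x, φ (Z (fun k => W k ω) n x) ∂μ n ∂P = ∫⁻ x, φ x ∂μ 0 := by
  induction n with
  | zero => simp [Z]
  | succ n ih =>
    have : IsProbabilityMeasure (β n) := by
      rw [← hβ]; exact Measure.isProbabilityMeasure_map (hW n).aemeasurable
    -- `U` retains only the variables entering `Z n`, hence is independent of `W n`.
    set U : Ω → ℕ → ℝ := fun ω k => if k < n then W k ω else 0 with hU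
    have hUm : Measurable U := by
      refine measurable_pi_lambda _ fun k => ?_
      by_cases hk : k < n
      · simp only [hU, hk, if_true]; exact hW k
      · simp only [hU, hk, if_false]; exact measurable_const
    have hZU : ∀ ω x, Z (fun k => W k ω) n x = Z (U ω) n x := fun ω x =>
      Z_congr (fun k hk => by simp [hU, hk]) x
    have hm : Measurable fun z : ((ℕ → ℝ) × ℝ) × ℝ => φ (Z z.1.1 n (moebius z.1.2 z.2)) := by
      have : Measurable fun z : ((ℕ → ℝ) × ℝ) × ℝ => (z.1.1, moebius z.1.2 z.2) := by
        unfold moebius; fun_prop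
      exact hφ.comp ((measurable_Z n).comp this)
    calc ∫⁻ ω, ∫⁻ x, φ (Z (fun k => W k ω) (n + 1) x) ∂μ (n + 1) ∂P
        = ∫⁻ ω, ∫⁻ x, φ (Z (U ω) n (moebius (W n ω) x)) ∂μ (n + 1) ∂P := by
          simp only [Z, hZU]
      _ = ∫⁻ ω, ∫⁻ w, ∫⁻ x, φ (Z (U ω) n (moebius w x)) ∂μ (n + 1) ∂β n ∂P := by
          rw [← hβ]
          exact lintegral_of_indepFun hUm (hW n) (indepFun_truncate hW hind n)
            (F := fun z => ∫⁻ x, φ (Z z.1 n (moebius z.2 x)) ∂μ (n + 1)) hm.lintegral_prod_right'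
      -- For frozen `U ω`, Tonelli and `hstep` applied to `φ ∘ Z (U ω) n` absorb the innermost map.
      _ = ∫⁻ ω, ∫⁻ x, φ (Z (U ω) n x) ∂μ n ∂P := by
          refine lintegral_congr fun ω => ?_
          rw [← hstep n (fun x => φ (Z (U ω) n x))
            (hφ.comp ((measurable_Z n).comp measurable_prodMk_left))]
          refine lintegral_lintegral_swap (Measurable.aemeasurable ?_)
          have : Measurable fun z : ℝ × ℝ => ((U ω, z.1), z.2) := by fun_prop
          exact hm.comp this
      _ = _ := by simp only [← hZU, ih]

theorem map_Z (hW : ∀ n, Measurable (W n)) (hind : iIndepFun W P)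
    (hβ : ∀ n, P.map (W n) = β n)
    (hstep : ∀ n (φ : ℝ → ENNReal), Measurable φ →
      ∫⁻ x, ∫⁻ w, φ (moebius w x) ∂β n ∂μ (n + 1) = ∫⁻ x, φ x ∂μ n) (n : ℕ) :
    (P.prod (μ n)).map (fun z => Z (fun k => W k z.1) n z.2) = μ 0 := by
  have hm : Measurable fun z : Ω × ℝ => Z (fun k => W k z.1) n z.2 :=
    (measurable_Z n).comp (f := fun z : Ω × ℝ => ((fun k => W k z.1), z.2)) (by fun_prop)
  refine Measure.ext_of_lintegral _ fun φ hφ => ?_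
  rw [lintegral_map hφ hm, lintegral_prod (fun z => φ (Z (fun k => W k z.1) n z.2))
    (hφ.comp hm).aemeasurable, ← lintegral_Z hW hind hβ hstep hφ n]

theorem osc_le_one {w : ℕ → ℝ} (hw : ∀ k, 0 ≤ w k) (n : ℕ) : osc w n ≤ 1 :=
  Finset.prod_le_one (fun k _ => div_nonneg (hw k) (by linarith [hw k])) fun k _ => by
    rw [div_le_one (by linarith [hw k])]
    linarith

/-- The limit of the random continued fraction has law `μ 0`. -/
theorem map_limit_Z (hμ : ∀ n, ∀ᵐ x ∂μ n, x ∈ Set.Ioo (0 : ℝ) 1)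
    (hW : ∀ n, Measurable (W n)) (hind : iIndepFun W P) (hβ : ∀ n, P.map (W n) = β n)
    (hstep : ∀ n (φ : ℝ → ENNReal), Measurable φ →
      ∫⁻ x, ∫⁻ w, φ (moebius w x) ∂β n ∂μ (n + 1) = ∫⁻ x, φ x ∂μ n)
    (hpos : ∀ᵐ ω ∂P, ∀ k, 0 < W k ω) (hfreq : ∀ᵐ ω ∂P, ∃ᶠ k in atTop, W k ω ≤ 1)
    {Y : Ω → ℝ} (hY : AEMeasurable Y P)
    (hlim : ∀ᵐ ω ∂P, Tendsto (fun n => Z (fun k => W k ω) n 0) atTop (𝓝 (Y ω))) :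
    P.map Y = μ 0 := by
  have h0 : (0 : ℝ) ∈ Set.Icc (0 : ℝ) 1 := ⟨le_rfl, zero_le_one⟩
  have hZm : ∀ n, Measurable fun z : Ω × ℝ => Z (fun k => W k z.1) n z.2 := fun n =>
    (measurable_Z n).comp (f := fun z : Ω × ℝ => ((fun k => W k z.1), z.2)) (by fun_prop)
  have hZ0 : ∀ n, Measurable fun ω : Ω => Z (fun k => W k ω) n 0 := fun n =>
    (hZm n).comp measurable_prodMk_right
  have hom : ∀ n, Measurable fun ω : Ω => osc (fun k => W k ω) n := fun n => by
    unfold osc; fun_prop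
  have := Measure.isProbabilityMeasure_map hY
  -- `D n` bounds the distance from `Y` to `Z n x` for every `x` in `(0,1)` at once.
  set D : ℕ → Ω → ℝ := fun n ω => osc (fun k => W k ω) n + |Z (fun k => W k ω) n 0 - Y ω| with hD
  have hDm : ∀ n, AEStronglyMeasurable (D n) P := fun n =>
    ((hom n).aemeasurable.add ((hZ0 n).aemeasurable.sub hY).abs).aestronglyMeasurable
  have hDbound : ∀ n, ∀ᵐ ω ∂P, ‖D n ω‖ ≤ 2 := fun n => by
    filter_upwards [hpos, hlim] with ω hω hω2
    have hw : ∀ k, 0 ≤ W k ω := fun k => (hω k).le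
    have hYm : Y ω ∈ Set.Icc (0 : ℝ) 1 :=
      isClosed_Icc.mem_of_tendsto hω2 (Eventually.of_forall fun n => Z_mem_Icc hw n h0)
    have hZn := Z_mem_Icc hw n h0
    have h1 := osc_le_one hw n
    have h2 : 0 ≤ osc (fun k => W k ω) n := (abs_nonneg _).trans (abs_Z_sub_Z_le hw n h0 h0)
    have h3 : |Z (fun k => W k ω) n 0 - Y ω| ≤ 1 := by
      rw [abs_le]; constructor <;> linarith [hZn.1, hZn.2, hYm.1, hYm.2]
    rw [Real.norm_of_nonneg (by positivity)]
    linarith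
  have hDint : ∀ n, Integrable (D n) P := fun n =>
    Integrable.of_bound (hDm n) 2 (hDbound n)
  have hDlim : Tendsto (fun n => ∫ ω, D n ω ∂P) atTop (𝓝 0) := by
    have h := tendsto_integral_of_dominated_convergence (F := D) (f := fun _ => (0 : ℝ))
      (fun _ => (2 : ℝ)) hDm (integrable_const _) hDbound (by
        filter_upwards [hpos, hfreq, hlim] with ω h1 h2 h3
        have := (osc_tendsto_zero h1 h2).add ((h3.sub_const (Y ω)).abs)
        simpa using this)
    simpa using h
  have key : ∀ f : ℝ → ℝ, (∃ C, ∀ x y, dist (f x) (f y) ≤ C) → (∃ L, LipschitzWith L f) →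
      ∫ x, f x ∂(P.map Y) = ∫ x, f x ∂μ 0 := by
    rintro f ⟨C, hC⟩ ⟨L, hL⟩
    have hfb : ∀ x, ‖f x‖ ≤ C + ‖f 0‖ := fun x => by
      have := hC x 0
      rw [dist_eq_norm] at this
      linarith [norm_le_norm_add_norm_sub' (f x) (f 0)]
    have hfm := hL.continuous.measurable
    -- Coupling on `Ω × ℝ`: the second coordinate is a start `X_n ∼ μ n` independent of the `W k`.
    have hb : ∀ n, |∫ x, f x ∂μ 0 - ∫ x, f x ∂(P.map Y)| ≤ L * ∫ ω, D n ω ∂P := by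
      intro n
      have e1 : ∫ x, f x ∂μ 0 = ∫ z, f (Z (fun k => W k z.1) n z.2) ∂P.prod (μ n) := by
        rw [← map_Z hW hind hβ hstep n,
          integral_map (hZm n).aemeasurable hfm.aestronglyMeasurable]
      have e2 : ∫ x, f x ∂(P.map Y) = ∫ z, f (Y z.1) ∂P.prod (μ n) := by
        rw [integral_map hY hfm.aestronglyMeasurable,
          integral_fun_fst (μ := P) (ν := μ n) (fun ω => f (Y ω))]
        simp
      have e3 : ∫ ω, D n ω ∂P = ∫ z, D n z.1 ∂P.prod (μ n) := by
        rw [integral_fun_fst (μ := P) (ν := μ n) (f := D n)]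
        simp
      have i1 : Integrable (fun z : Ω × ℝ => f (Z (fun k => W k z.1) n z.2)) (P.prod (μ n)) :=
        Integrable.of_bound (hfm.comp (hZm n)).aestronglyMeasurable _
          (Eventually.of_forall fun _ => hfb _)
      have i2 : Integrable (fun z : Ω × ℝ => f (Y z.1)) (P.prod (μ n)) :=
        Integrable.of_bound (hfm.comp_aemeasurable hY.comp_fst).aestronglyMeasurable _
          (Eventually.of_forall fun _ => hfb _)
      rw [e1, e2, e3, ← integral_sub i1 i2, ← integral_const_mul, ← Real.norm_eq_abs]
      refine norm_integral_le_of_norm_le (((hDint n).comp_fst (μ n)).const_mul _) ?_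
      have a1 : ∀ᵐ z ∂P.prod (μ n), ∀ k, 0 < W k z.1 :=
        Measure.quasiMeasurePreserving_fst.ae hpos
      have a2 : ∀ᵐ z ∂P.prod (μ n), z.2 ∈ Set.Ioo (0 : ℝ) 1 :=
        Measure.quasiMeasurePreserving_snd.ae (hμ n)
      filter_upwards [a1, a2] with z hz1 hz2
      have hw : ∀ k, 0 ≤ W k z.1 := fun k => (hz1 k).le
      rw [← dist_eq_norm]
      refine (hL.dist_le_mul _ _).trans (mul_le_mul_of_nonneg_left ?_ L.coe_nonneg)
      refine (dist_triangle _ (Z (fun k => W k z.1) n 0) _).trans ?_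
      exact add_le_add (abs_Z_sub_Z_le hw n (Set.Ioo_subset_Icc_self hz2) h0) le_rfl
    have h1 := ge_of_tendsto' (hDlim.const_mul (L : ℝ)) hb
    rw [mul_zero] at h1
    have h2 := abs_nonpos_iff.1 h1
    linarith
  let ν : ProbabilityMeasure ℝ := ⟨P.map Y, this⟩
  let ν₀ : ProbabilityMeasure ℝ := ⟨μ 0, inferInstance⟩
  -- Bounded Lipschitz functions determine weak convergence, and weak limits are unique, so a
  -- constant sequence gives equality.
  have htend : Tendsto (fun _ : ℕ => ν) atTop (𝓝 ν₀) := by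
    rw [tendsto_iff_forall_lipschitz_integral_tendsto]
    intro f hC hL
    change Tendsto (fun _ : ℕ => ∫ x, f x ∂(P.map Y)) atTop (𝓝 (∫ x, f x ∂μ 0))
    rw [key f hC hL]
    exact tendsto_const_nhds
  exact congrArg (fun ρ : ProbabilityMeasure ℝ => (ρ : Measure ℝ)) (tendsto_nhds_unique tendsto_const_nhds htend)

/-- This is the second Borel–Cantelli lemma. -/
theorem ae_frequently_le_one (hW : ∀ n, Measurable (W n)) (hind : iIndepFun W P)
    (hsum : ∑' n, P {ω | W n ω ≤ 1} = ⊤) : ∀ᵐ ω ∂P, ∃ᶠ k in atTop, W k ω ≤ 1 := by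
  have hsm : ∀ n, MeasurableSet {ω | W n ω ≤ 1} := fun n => measurableSet_le (hW n) measurable_const
  have hs : iIndepSet (fun n => {ω | W n ω ≤ 1}) P := by
    rw [iIndepSet_iff_meas_biInter hsm]
    intro S
    exact (iIndepFun_iff_measure_inter_preimage_eq_mul.1 hind) S
      (sets := fun _ => Set.Iic 1) fun _ _ => measurableSet_Iic
  have h := measure_limsup_eq_one hsm hs hsum
  have h2 := (prob_compl_eq_zero_iff (MeasurableSet.measurableSet_limsup hsm)).2 h
  filter_upwards [measure_eq_zero_iff_ae_notMem.1 h2] with ω hω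
  rw [Set.notMem_compl_iff, mem_limsup_iff_frequently_mem] at hω
  exact hω

end probability

/-! ### The edges of the graph -/

/-- Swapping `θ 3` and `θ 4` fixes the triple and turns one kind of edge into the other, so a single
kind has to be treated. -/
theorem IsAcceptable.exists_succ₁ {v v' : Triple} (h : IsAcceptable v v') :
    ∃ θ : Fin 5 → ℝ, v = triple θ ∧ v' = succ₁ θ ∧ 0 < θ 1 + θ 2 ∧ 0 < θ 0 + θ 4 := by
  obtain ⟨θ, hv, h12, ⟨h', h0⟩ | ⟨h', h0⟩⟩ := h
  · exact ⟨θ, hv, h', h12, h0⟩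
  · refine ⟨![θ 0, θ 1, θ 2, θ 4, θ 3], ?_, ?_, h12, h0⟩
    · rw [hv]
      simp [triple, Sym2.eq_swap]
    · rw [h']
      simp [succ₁, succ₂]

theorem IsAcceptable.exists_betaPrime {v v' : Triple} (h : IsAcceptable v v') :
    ∃ c d : ℝ, 0 < c ∧ 0 < d ∧ edgeLaw v v' = betaPrime c d := by
  obtain ⟨θ, rfl, rfl, h12, h04⟩ := h.exists_succ₁
  exact ⟨_, _, h04, h12, edgeLaw_succ₁ θ⟩

/-- The endpoint of the edge from `v_θ` to `v₁` in a suitable order. -/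
theorem triple_succ₁ (θ : Fin 5 → ℝ) : triple ![θ 4, θ 3, θ 0, θ 1, θ 2] = succ₁ θ := by
  simp [triple, succ₁, Sym2.eq_swap]

theorem lintegral_moebius_BHθ {θ : Fin 5 → ℝ} (h0 : ThetaAdmissible θ) (h12 : 0 < θ 1 + θ 2)
    (h04 : 0 < θ 0 + θ 4) [IsProbabilityMeasure (betaPrime (θ 0 + θ 4) (θ 1 + θ 2))]
    {φ : ℝ → ENNReal} (hφ : Measurable φ) :
    ∫⁻ x, ∫⁻ w, φ (moebius w x) ∂betaPrime (θ 0 + θ 4) (θ 1 + θ 2) ∂BHθ θ =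
      ∫⁻ y, φ y ∂BHθ ![θ 4, θ 3, θ 0, θ 1, θ 2] := by
  have h := lintegral_moebius_BH (c := θ 0 + θ 4) (d := θ 1 + θ 2) h0 h04 h12 (by ring) (by ring) hφ
  rw [BHθ, h]
  congr 1
  simp only [BHθ, Matrix.cons_val]
  congr 1 <;> ring

/-- The representatives `θ, θ'` are arbitrary; both laws are moved to the ordering `η` that exhibits
the edge. -/
theorem lintegral_moebius_edge {θ θ' : Fin 5 → ℝ} (h : IsAcceptable (triple θ) (triple θ'))
    (h0 : ThetaAdmissible θ) (h0' : ThetaAdmissible θ')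
    [IsProbabilityMeasure (edgeLaw (triple θ) (triple θ'))]
    {φ : ℝ → ENNReal} (hφ : Measurable φ) :
    ∫⁻ x, ∫⁻ w, φ (moebius w x) ∂edgeLaw (triple θ) (triple θ') ∂BHθ θ = ∫⁻ y, φ y ∂BHθ θ' := by
  obtain ⟨η, h1, h2, h12, h04⟩ := h.exists_succ₁
  have e : edgeLaw (triple θ) (triple θ') = betaPrime (η 0 + η 4) (η 1 + η 2) := by
    rw [h1, h2, edgeLaw_succ₁]
  obtain ⟨a1, a2⟩ := thetaAdmissible_and_BHθ_eq_of_triple_eq h1 h0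
  obtain ⟨-, a3⟩ := thetaAdmissible_and_BHθ_eq_of_triple_eq (h2.trans (triple_succ₁ η).symm) h0'
  have : IsProbabilityMeasure (betaPrime (η 0 + η 4) (η 1 + η 2)) := e ▸ inferInstance
  rw [e, a2, a3]
  exact lintegral_moebius_BHθ a1 h12 h04 hφ

theorem ae_pos_betaPrime (c d : ℝ) : ∀ᵐ w ∂betaPrime c d, 0 < w :=
  (withDensity_absolutelyContinuous _ _).ae_le (ae_restrict_mem measurableSet_Ioi)

theorem betaPrime_Iic_one_pos {c d : ℝ} (hc : 0 < c) (hd : 0 < d) :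
    0 < betaPrime c d (Set.Iic 1) := by
  have hB := beta_pos hc hd
  refine lt_of_lt_of_le ?_ (measure_mono fun x (hx : x ∈ Set.Ioo (0 : ℝ) 1) => hx.2.le)
  rw [betaPrime, withDensity_apply _ measurableSet_Ioo, setLIntegral_pos_iff (by fun_prop),
    Measure.restrict_apply' measurableSet_Ioi]
  have hsub : Set.Ioo (0 : ℝ) 1 ⊆ Function.support (fun w : ℝ =>
      ENNReal.ofReal (1 / beta c d * (w ^ (c - 1) / (1 + w) ^ (c + d)))) ∩ Set.Ioo 0 1 ∩
        Set.Ioi 0 := by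
    intro w hw
    refine ⟨⟨?_, hw⟩, hw.1⟩
    have h1 := Real.rpow_pos_of_pos hw.1 (c - 1)
    have h2 := Real.rpow_pos_of_pos (x := 1 + w) (by linarith [hw.1]) (c + d)
    rw [Function.mem_support, Ne, ENNReal.ofReal_eq_zero, not_le]
    positivity
  refine lt_of_lt_of_le ?_ (measure_mono hsub)
  simp

theorem finite_Vert (θ : Fin 5 → ℝ) : (Vert θ).Finite := by
  have : Vert θ = Set.range fun σ : Equiv.Perm (Fin 5) => triple (θ ∘ σ) := by
    ext v
    simp [Vert, eq_comm]
  rw [this]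
  exact Set.finite_range _

/-- Finitely many vertices give finitely many edge laws, so the terms are bounded below by a
positive minimum. -/
theorem tsum_edgeLaw_eq_top {θ : Fin 5 → ℝ} {v : ℕ → Vert θ}
    (hv : ∀ n, IsAcceptable (v (n + 1)).1 (v n).1) :
    ∑' n, edgeLaw (v (n + 1)).1 (v n).1 (Set.Iic 1) = ⊤ := by
  have hfin : (Set.range fun n => edgeLaw (v (n + 1)).1 (v n).1 (Set.Iic 1)).Finite := by
    refine (((finite_Vert θ).prod (finite_Vert θ)).image
      fun e => edgeLaw e.1 e.2 (Set.Iic 1)).subset ?_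
    rintro _ ⟨n, rfl⟩
    exact ⟨((v (n + 1)).1, (v n).1), ⟨(v (n + 1)).2, (v n).2⟩, rfl⟩
  obtain ⟨m, hm, hmin⟩ := Set.exists_min_image _ id hfin (Set.range_nonempty _)
  have hpos : m ≠ 0 := by
    obtain ⟨N, hN⟩ := hm
    obtain ⟨c, d, hc, hd, h⟩ := (hv N).exists_betaPrime
    rw [← hN]
    change edgeLaw (v (N + 1)).1 (v N).1 (Set.Iic 1) ≠ 0
    rw [h]
    exact (betaPrime_Iic_one_pos hc hd).ne'
  rw [eq_top_iff, ← ENNReal.tsum_const_eq_top_of_ne_zero (α := ℕ) hpos]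
  exact ENNReal.tsum_le_tsum fun n => hmin _ ⟨n, rfl⟩

end BetaHyp

end

/-- The random continued fraction along an infinite path converges almost surely, and its limit has
the beta hypergeometric law of the endpoint. -/
theorem theorem4p2 (θ : Fin 5 → ℝ)
    (v : ℕ → {u : BetaHyp.Vert θ // BetaHyp.BHExists u})
    (hv : ∀ n, (BetaHyp.Gstarstar θ).Adj (v (n + 1)) (v n))
    {Ω : Type*} [MeasurableSpace Ω] (P : Measure Ω) [IsProbabilityMeasure P]
    (W : ℕ → Ω → ℝ)
    (hind : iIndepFun W P)
    (hW : ∀ n, HasLaw (W n) (BetaHyp.edgeLaw (v (n + 1)).1.1 (v n).1.1) P) :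
    ∃ Zlim : Ω → ℝ,
      (∀ᵐ ω ∂P, ∀ x : ℝ, 0 ≤ x →
        Tendsto (fun n => BetaHyp.Z (fun k => W k ω) n x) atTop (𝓝 (Zlim ω))) ∧
      ∀ θ' : Fin 5 → ℝ, BetaHyp.triple θ' = (v 0).1.1 → HasLaw Zlim (BetaHyp.BHθ θ') P := by
  classical
  have hacc : ∀ n, BetaHyp.IsAcceptable (v (n + 1)).1.1 (v n).1.1 := fun n => (hv n).2
  choose η hη hηa using fun n => (v n).2
  -- `HasLaw` gives only a.e. measurability, so measurable versions are used.
  set W' : ℕ → Ω → ℝ := fun n => (hW n).aemeasurable.mk (W n) with hW'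
  have hWm : ∀ n, Measurable (W' n) := fun n => (hW n).aemeasurable.measurable_mk
  have hae : ∀ n, W n =ᵐ[P] W' n := fun n => (hW n).aemeasurable.ae_eq_mk
  have hind' : iIndepFun W' P := hind.congr hae
  have hlaw : ∀ n, P.map (W' n) = BetaHyp.edgeLaw (v (n + 1)).1.1 (v n).1.1 := fun n => by
    rw [← (hW n).map_eq, Measure.map_congr (hae n)]
  -- The edge laws have mass one because they are laws of the `W n`.
  have hprob : ∀ n, IsProbabilityMeasure (BetaHyp.edgeLaw (v (n + 1)).1.1 (v n).1.1) := fun n => by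
    rw [← hlaw]
    exact Measure.isProbabilityMeasure_map (hWm n).aemeasurable
  have hpos : ∀ᵐ ω ∂P, ∀ k, 0 < W' k ω := by
    refine ae_all_iff.2 fun k => ?_
    obtain ⟨c, d, -, -, h⟩ := (hacc k).exists_betaPrime
    have := BetaHyp.ae_pos_betaPrime c d
    rw [← h, ← hlaw] at this
    exact ae_of_ae_map (hWm k).aemeasurable this
  have hfreq : ∀ᵐ ω ∂P, ∃ᶠ k in atTop, W' k ω ≤ 1 := by
    refine BetaHyp.ae_frequently_le_one hWm hind' ?_
    rw [← BetaHyp.tsum_edgeLaw_eq_top (v := fun n => (v n).1) hacc]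
    refine tsum_congr fun n => ?_
    rw [← hlaw, Measure.map_apply (hWm n) measurableSet_Iic]
    rfl
  have hex : ∀ᵐ ω ∂P, ∃ L, ∀ x : ℝ, 0 ≤ x →
      Tendsto (fun n => BetaHyp.Z (fun k => W k ω) n x) atTop (𝓝 L) := by
    filter_upwards [hpos, hfreq, ae_all_iff.2 hae] with ω h1 h2 h3
    simp only [h3]
    exact BetaHyp.exists_tendsto_Z h1 h2
  -- The value `0` is taken only on a null set.
  set Y : Ω → ℝ := fun ω => if h : ∃ L, ∀ x : ℝ, 0 ≤ x →
      Tendsto (fun n => BetaHyp.Z (fun k => W k ω) n x) atTop (𝓝 L) then h.choose else 0 with hY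
  have hYlim : ∀ᵐ ω ∂P, ∀ x : ℝ, 0 ≤ x →
      Tendsto (fun n => BetaHyp.Z (fun k => W k ω) n x) atTop (𝓝 (Y ω)) := by
    filter_upwards [hex] with ω h
    simp only [hY, h, dite_true]
    exact h.choose_spec
  have hYlim' : ∀ᵐ ω ∂P,
      Tendsto (fun n => BetaHyp.Z (fun k => W' k ω) n 0) atTop (𝓝 (Y ω)) := by
    filter_upwards [hYlim, ae_all_iff.2 hae] with ω h1 h3
    simpa only [h3] using h1 0 le_rfl
  have hYm : AEMeasurable Y P :=
    aemeasurable_of_tendsto_metrizable_ae atTop (fun n => ((BetaHyp.measurable_Z n).comp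
      (f := fun ω => ((fun k => W' k ω), (0 : ℝ))) (by fun_prop)).aemeasurable) hYlim'
  have : ∀ n, IsProbabilityMeasure (BetaHyp.BHθ (η n)) := fun n =>
    BetaHyp.isProbabilityMeasure_BH (hηa n)
  have hmap : P.map Y = BetaHyp.BHθ (η 0) := by
    refine BetaHyp.map_limit_Z (μ := fun n => BetaHyp.BHθ (η n))
      (fun n => BetaHyp.ae_mem_Ioo_BH _ _ _ _ _) hWm hind' hlaw (fun n φ hφ => ?_)
      hpos hfreq hYm hYlim'
    have h1 := hacc n
    have h2 := hprob n
    simp only [← hη] at h1 h2 ⊢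
    exact BetaHyp.lintegral_moebius_edge h1 (hηa _) (hηa _) hφ
  refine ⟨Y, hYlim, fun θ' hθ' => ⟨hYm, ?_⟩⟩
  rw [hmap, (BetaHyp.thetaAdmissible_and_BHθ_eq_of_triple_eq ((hη 0).trans hθ'.symm) (hηa 0)).2]
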